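/- **Setting.** Let $m\ge 1$, $M=2^m$, $\sigma>0$, $\Delta=\sqrt{3/(2(M^2-1))}$ and, for $0\le j\le M/2-1$, $$w_j=\frac{2\,(2^{m-\lceil\log_2(j+1)\rceil}-1)}{mM},\qquad \mu_j=\frac{2\Delta^2(j+1)^2}{\sigma^2},\qquad \sigma_j^2=\frac{4\Delta^2(j+1)^2}{\sigma^2}.$$ For BICM with $M^2$-QAM, binary reflected Gray mapping and noise variance $\sigma^2$ per real dimension, the max-log LLR $l$ of a transmitted bit $b$ is modelled by the density $p(l|b)=\sum_{j=0}^{M/2-1}w_j\,\mathsf G(l;(-1)^b\mu_j,\sigma_j^2)$, where $\mathsf G(\cdot\,;\mu,\sigma^2)$ is the Gaussian density. Channel adapters symmetrize it: $p(\bar l=l|b)=\tfrac12\,(p(l|b)+p(-l|1-b))$. Let $\mathcal C$ be a binary linear code of length $n\ge1$ with minimum distance $d_{\min}$ and $t=\lfloor (d_{\min}-1)/2\rfloor$, such that no coordinate is identically zero on $\mathcal C$ (for instance a BCH code). Consider the GLDPC ensemble with $K$ row-type and $K$ column-type constraint nodes (CNs) of degree $n$, all with component code $\mathcal C$, and $nK$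 variable nodes (VNs), each attached to one row-type and one column-type CN through a uniformly random edge interleaver. The all-zero codeword is sent, and the channel LLRs of the VNs are independent with density $p(\bar l|0)$. Let $\mathsf B(l)=1$ if $l<0$ and $\mathsf B(l)=0$ otherwise. In extrinsic iBDD-CR, the messages are bits. At iteration $0$ each VN carries the hard decision $\mathsf B(\bar l)$; each iteration $\ell\ge1$ consists of a row step followed by a column step. For each of its bits, an active CN replaces the incoming message on that bit by the channel hard decision $\mathsf B(\bar l)$, applies bounded distance decoding of radius $t$ to the resulting word, and gets an output $\bar\mu\in\{1,-1,0\}$ for the bit (decoded to $0$, decoded to $1$, failure). It then sends $\mathsf B(\tilde l)$, where $$\tilde l=\ln\frac{p(\bar\mu,\bar l\,|\,c=0)}{p(\bar\mu,\bar l\,|\,c=1)},\qquad p(\bar\mu,\bar l\,|\,c=b)=p(\bar\mu\,|\,\mathsf B(\bar l),c=b)\,p(\bar l|b).$$ Here $p(\bar\mu|r,c=b)$ is computed for a uniformly random bit of a uniformly random component codeword, given that the bit is $b$ and that its channel hard decision is $r$, the other $n-1$ bits being received in error independently with probability $x$; $x$ is the message error probability at the input of the CN. Let $x^{\mathsf r,(\ell)}$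 ($\ell\ge1$) and $x^{\mathsf c,(\ell)}$ ($\ell\ge0$) be the ensemble-average error probabilities of the messages sent at iteration $\ell$ by row-type and by column-type CNs, in the limit $K\to\infty$ ($x^{\mathsf c,(0)}$ being that of the initial hard decisions). The combining rule uses $x=x^{\mathsf c,(\ell-1)}$ in the row step and $x=x^{\mathsf r,(\ell)}$ in the column step of iteration $\ell$. For a uniformly random bit of the all-zero component codeword, with $i$ errors uniformly placed in the other $n-1$ positions, let $P^{\mathsf e}(i),P^{\mathsf c}(i)$ be the probabilities that bounded distance decoding decodes the bit incorrectly and correctly when it is received in error, let $Q^{\mathsf e}(i),Q^{\mathsf c}(i)$ be the same when it is received correctly, and let $P^\epsilon=1-P^{\mathsf e}-P^{\mathsf c}$, $Q^\epsilon=1-Q^{\mathsf e}-Q^{\mathsf c}$. For each of these six functions $A$ let $f^{A}(x)=\sum_{i=0}^{n-1}\binom{n-1}{i}x^i(1-x)^{n-1-i}A(i)$. Let $\mathsf Q(x)=\frac1{\sqrt{2\pi}}\int_x^\infty e^{-\xi^2/2}d\xi$, and let $\bar{\mathbb U}(x)=1$ if $x<0$ and $0$ otherwise. **Proposition 2.**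 These limits exist (the probabilities $x^{\mathsf c,(0)},x^{\mathsf r,(1)},x^{\mathsf c,(1)},\dots$ are well defined), and $$x^{\mathsf c,(0)}=\sum_{j=0}^{M/2-1}w_j\,\mathsf Q\!\left(\frac{\mu_j}{\sigma_j}\right),\qquad x^{\mathsf r,(\ell)}=\mathsf g(x^{\mathsf c,(\ell-1)}),\qquad x^{\mathsf c,(\ell)}=\mathsf g(x^{\mathsf r,(\ell)})\qquad(\ell\ge1),$$ where, with all functions $f$ taken at $x$, $$\mathsf g(x)=\sum_{(A,B)}f^{A}\sum_{j=0}^{M/2-1}w_j\,\mathsf Q\!\left(\frac{\max(\ln\frac{f^{A}}{f^{B}},0)+\mu_j}{\sigma_j}\right)+\sum_{(A,B)}f^{B}\,\bar{\mathbb U}\!\left(\ln\tfrac{f^{B}}{f^{A}}\right)\sum_{j=0}^{M/2-1}w_j\left(\mathsf Q\!\left(\frac{\ln\frac{f^{B}}{f^{A}}+\mu_j}{\sigma_j}\right)-\mathsf Q\!\left(\frac{\mu_j}{\sigma_j}\right)\right)$$ and $(A,B)$ runs over $(P^{\mathsf e},Q^{\mathsf c})$, $(P^{\mathsf c},Q^{\mathsf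 e})$, $(P^{\epsilon},Q^{\epsilon})$; terms of a pair with $f^A=f^B=0$ are zero. -/

import Mathlib

open MeasureTheory ProbabilityTheory Filter Topology

namespace IBDDCR

noncomputable section

/-! ### The BICM channel -/

/-- Tail probability of the standard Gaussian distribution. -/
def Q (x : ℝ) : ℝ :=
  (√(2 * Real.pi))⁻¹ * ∫ ξ in Set.Ioi x, Real.exp (-ξ ^ 2 / 2)

/-- Scaling factor of the `M`-ASK constellation, `M = 2 ^ m`, normalizing `M²`-QAM to unit energy. -/
def Delta (m : ℕ) : ℝ := √(3 / (2 * (((2 : ℝ) ^ m) ^ 2 - 1)))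

/-- Weight `w_j` of the `j`-th mixture component; `Nat.clog 2 (j + 1)` is `⌈log₂ (j + 1)⌉`, which
is at most `m - 1` for the indices `j < 2 ^ m / 2` that occur. -/
def weight (m j : ℕ) : ℝ :=
  2 * ((2 : ℝ) ^ (m - Nat.clog 2 (j + 1)) - 1) / (m * 2 ^ m)

/-- Mean `μ_j` of the `j`-th mixture component. -/
def mean (m : ℕ) (σ : ℝ) (j : ℕ) : ℝ := 2 * Delta m ^ 2 * (j + 1) ^ 2 / σ ^ 2

/-- Variance `σ_j²` of the `j`-th mixture component. -/
def var (m : ℕ) (σ : ℝ) (j : ℕ) : ℝ := 4 * Delta m ^ 2 * (j + 1) ^ 2 / σ ^ 2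

/-- Standard deviation `σ_j` of the `j`-th mixture component. -/
def sd (m : ℕ) (σ : ℝ) (j : ℕ) : ℝ := √(var m σ j)

/-- The Gaussian-mixture model `p(l | b)` of the max-log LLR `l` of a transmitted bit `b`. -/
def llrPdf (m : ℕ) (σ : ℝ) (b : ZMod 2) (l : ℝ) : ℝ :=
  ∑ j ∈ Finset.range (2 ^ m / 2),
    weight m j * gaussianPDFReal ((-1) ^ b.val * mean m σ j) (var m σ j).toNNReal l

/-- The LLR density of the channel symmetrized by channel adapters. -/
def symLlrPdf (m : ℕ) (σ : ℝ) (b : ZMod 2) (l : ℝ) : ℝ :=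
  (llrPdf m σ b l + llrPdf m σ (1 - b) (-l)) / 2

/-- The law of the symmetrized LLR of a transmitted bit `b`. -/
def symLlrLaw (m : ℕ) (σ : ℝ) (b : ZMod 2) : Measure ℝ :=
  volume.withDensity fun l => ENNReal.ofReal (symLlrPdf m σ b l)

/-- Hard decision on a soft value: negative values give bit `1`, the others bit `0`. -/
def hardBit (l : ℝ) : ZMod 2 := if l < 0 then 1 else 0

/-! ### Component code and bounded distance decoding -/

variable {n : ℕ}

/-- Minimum Hamming distance of a binary linear code. -/
def minDist (C : Submodule (ZMod 2) (Fin n → ZMod 2)) : ℕ :=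
  sInf {d | ∃ c ∈ C, ∃ c' ∈ C, c ≠ c' ∧ hammingDist c c' = d}

open scoped Classical in
/-- Output of bounded distance decoding with radius `t` at position `j`, for the input word `w`:
`1` or `-1` if the codeword within distance `t` of `w` has a `0` or a `1` at position `j`, and `0`
if there is no such codeword. (For `2 t < minDist C` there is at most one such codeword.) -/
def bddOut (C : Submodule (ZMod 2) (Fin n → ZMod 2)) (t : ℕ) (w : Fin n → ZMod 2) (j : Fin n) :
    SignType :=
  if ∃ c ∈ C, hammingDist c w ≤ t ∧ c j = 0 then 1
  else if ∃ c ∈ C, hammingDist c w ≤ t ∧ c j = 1 then -1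
  else 0

/-! ### The combining rule of iBDD-CR -/

open scoped Classical in
/-- Conditional probability `p(μ̄ = s | r, c = b)` that extrinsic bounded distance decoding outputs
`s` on a bit, given that the bit is `b` and that its channel hard decision is `r`. The transmitted
codeword `c` is uniform on the code, the position `j` of the bit is uniform, and the bits at the
other positions are received in error independently with probability `x` (`e` is the error
pattern). -/
def outProb (C : Submodule (ZMod 2) (Fin n → ZMod 2)) (t : ℕ) (x : ℝ) (b r : ZMod 2)
    (s : SignType) : ℝ :=
  (∑ j : Fin n, ∑ c : Fin n → ZMod 2 with c ∈ C ∧ c j = b,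
      ∑ e : Fin n → ZMod 2 with c j + e j = r ∧ bddOut C t (c + e) j = s,
        ∏ i ∈ Finset.univ.erase j, (if e i = 1 then x else 1 - x)) /
    ∑ j : Fin n, ((Finset.univ.filter fun c : Fin n → ZMod 2 => c ∈ C ∧ c j = b).card : ℝ)

/-- The soft value `ln (p(μ̄, l | c = 0) / p(μ̄, l | c = 1))` of a bit, given its extrinsic bounded
distance decoding output `s` and its channel LLR `l`; `x` is the error probability of the
messages entering the constraint node. As the decoder sees `l` only through its hard decision,
`p(μ̄, l | c = b) = p(μ̄ | r, c = b) * p(l | c = b)` with `r` the hard decision on `l`. -/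
def softValue (C : Submodule (ZMod 2) (Fin n → ZMod 2)) (t m : ℕ) (σ x : ℝ) (s : SignType)
    (l : ℝ) : ℝ :=
  Real.log ((outProb C t x 0 (hardBit l) s * symLlrPdf m σ 0 l) /
    (outProb C t x 1 (hardBit l) s * symLlrPdf m σ 1 l))

/-- Outgoing message of a constraint node at position `j`: the node replaces the incoming bit at
`j` by the channel hard decision, decodes, combines the result with the channel LLR `l` of that
bit, and takes a hard decision. -/
def cnMessage (C : Submodule (ZMod 2) (Fin n → ZMod 2)) (t m : ℕ) (σ x : ℝ)
    (ψ : Fin n → ZMod 2) (j : Fin n) (l : ℝ) : ZMod 2 :=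
  hardBit (softValue C t m σ x (bddOut C t (Function.update ψ j (hardBit l)) j) l)

/-! ### The GLDPC ensemble and its message passing decoder -/

/-- Sockets of `K` constraint nodes of degree `n`. A graph of the ensemble has `K` row-type and `K`
column-type constraint nodes and `K * n` variable nodes of degree two. Variable nodes are named by
the row socket to which they are attached; the edge interleaver is a permutation `π`, and variable
node `v` is attached to the column socket `π v`. -/
abbrev Socket (K n : ℕ) := Fin K × Fin n

/-- Messages sent by all row-type constraint nodes, for incoming messages `ψ`. -/
def rowStep (C : Submodule (ZMod 2) (Fin n → ZMod 2)) (t m : ℕ) (σ x : ℝ) {K : ℕ}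
    (l : Socket K n → ℝ) (ψ : Socket K n → ZMod 2) : Socket K n → ZMod 2 :=
  fun v => cnMessage C t m σ x (fun i => ψ (v.1, i)) v.2 (l v)

/-- Messages sent by all column-type constraint nodes, for incoming messages `ψ`. -/
def colStep (C : Submodule (ZMod 2) (Fin n → ZMod 2)) (t m : ℕ) (σ x : ℝ) {K : ℕ}
    (π : Equiv.Perm (Socket K n)) (l : Socket K n → ℝ) (ψ : Socket K n → ZMod 2) :
    Socket K n → ZMod 2 :=
  fun v => cnMessage C t m σ x (fun i => ψ (π.symm ((π v).1, i))) (π v).2 (l v)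

/-- The messages of extrinsic iBDD-CR sent by the column-type constraint nodes at iteration `ℓ`,
for channel LLRs `l`; iteration `0` stands for the channel hard decisions. The combining rule is
run with the input error probabilities `xc (ℓ - 1)` (row step of iteration `ℓ`) and `xr ℓ` (column
step of iteration `ℓ`). -/
def colMsg (C : Submodule (ZMod 2) (Fin n → ZMod 2)) (t m : ℕ) (σ : ℝ) (xr xc : ℕ → ℝ) {K : ℕ}
    (π : Equiv.Perm (Socket K n)) (l : Socket K n → ℝ) : ℕ → Socket K n → ZMod 2
  | 0 => fun v => hardBit (l v)
  | ℓ + 1 =>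
    colStep C t m σ (xr (ℓ + 1)) π l (rowStep C t m σ (xc ℓ) l (colMsg C t m σ xr xc π l ℓ))

/-- The messages sent by the row-type constraint nodes at iteration `ℓ + 1`. -/
def rowMsgSucc (C : Submodule (ZMod 2) (Fin n → ZMod 2)) (t m : ℕ) (σ : ℝ) (xr xc : ℕ → ℝ) {K : ℕ}
    (π : Equiv.Perm (Socket K n)) (l : Socket K n → ℝ) (ℓ : ℕ) : Socket K n → ZMod 2 :=
  rowStep C t m σ (xc ℓ) l (colMsg C t m σ xr xc π l ℓ)

/-- Ensemble average of the message error probability when the all-zero codeword is sent: the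
interleaver and the variable node are uniform, and the LLRs are independent with the law of the
symmetrized LLR of a zero bit. `msg π l v` is the message on the edge of `v`. -/
def avgErr (m : ℕ) (σ : ℝ) (n K : ℕ)
    (msg : Equiv.Perm (Socket K n) → (Socket K n → ℝ) → Socket K n → ZMod 2) : ℝ :=
  (∑ π : Equiv.Perm (Socket K n), ∑ v : Socket K n,
      (Measure.pi fun _ : Socket K n => symLlrLaw m σ 0).real {l | msg π l v = 1}) /
    (Fintype.card (Equiv.Perm (Socket K n)) * Fintype.card (Socket K n))

/-- `xr` and `xc` are the message error probabilities of iBDD-CR at the row-type and the column-type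
constraint nodes of the GLDPC ensemble, in the limit of infinite block length, when the
combining rule of the decoder uses these same probabilities. -/
def IsMessageErrorProb (C : Submodule (ZMod 2) (Fin n → ZMod 2)) (t m : ℕ) (σ : ℝ)
    (xr xc : ℕ → ℝ) : Prop :=
  (∀ ℓ, Tendsto (fun K => avgErr m σ n K fun π l => colMsg C t m σ xr xc π l ℓ) atTop
    (𝓝 (xc ℓ))) ∧
  ∀ ℓ, Tendsto (fun K => avgErr m σ n K fun π l => rowMsgSucc C t m σ xr xc π l ℓ) atTop
    (𝓝 (xr (ℓ + 1)))

/-! ### The density evolution map -/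

open scoped Classical in
/-- Probability that a randomly selected bit of the all-zero codeword is decoded to `s` by bounded
distance decoding, when it is received as `r` and there are `i` errors, uniformly placed, in the
other `n - 1` positions. -/
def decProb (C : Submodule (ZMod 2) (Fin n → ZMod 2)) (t : ℕ) (r : ZMod 2) (s : SignType)
    (i : ℕ) : ℝ :=
  (∑ j : Fin n,
      (((Finset.univ.erase j).powersetCard i).filter fun S =>
        bddOut C t (fun k => if k = j then r else if k ∈ S then 1 else 0) j = s).card /
      ((n - 1).choose i : ℝ)) / n

/-- Average of `P i` over the binomially distributed number `i` of errors in `n - 1` positions. -/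
def binAvg (n : ℕ) (P : ℕ → ℝ) (x : ℝ) : ℝ :=
  ∑ i ∈ Finset.range n, ((n - 1).choose i : ℝ) * x ^ i * (1 - x) ^ (n - i - 1) * P i

/-- Initially in error, decoded incorrectly. -/
def fPe (C : Submodule (ZMod 2) (Fin n → ZMod 2)) (t : ℕ) : ℝ → ℝ := binAvg n (decProb C t 1 (-1))

/-- Initially in error, decoded correctly. -/
def fPc (C : Submodule (ZMod 2) (Fin n → ZMod 2)) (t : ℕ) : ℝ → ℝ := binAvg n (decProb C t 1 1)

/-- Initially in error, erased. -/
def fPeps (C : Submodule (ZMod 2) (Fin n → ZMod 2)) (t : ℕ) : ℝ → ℝ :=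
  binAvg n fun i => 1 - decProb C t 1 (-1) i - decProb C t 1 1 i

/-- Initially correct, decoded incorrectly. -/
def fQe (C : Submodule (ZMod 2) (Fin n → ZMod 2)) (t : ℕ) : ℝ → ℝ := binAvg n (decProb C t 0 (-1))

/-- Initially correct, decoded correctly. -/
def fQc (C : Submodule (ZMod 2) (Fin n → ZMod 2)) (t : ℕ) : ℝ → ℝ := binAvg n (decProb C t 0 1)

/-- Initially correct, erased. -/
def fQeps (C : Submodule (ZMod 2) (Fin n → ZMod 2)) (t : ℕ) : ℝ → ℝ :=
  binAvg n fun i => 1 - decProb C t 0 (-1) i - decProb C t 0 1 i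

/-- Indicator of the negative half line. -/
def Ubar (x : ℝ) : ℝ := if x < 0 then 1 else 0

/-- The weighted sum `∑ j, w_j Q((a + μ_j) / σ_j)`. -/
def mixQ (m : ℕ) (σ a : ℝ) : ℝ :=
  ∑ j ∈ Finset.range (2 ^ m / 2), weight m j * Q ((a + mean m σ j) / sd m σ j)

/-- The weighted sum `∑ j, w_j (Q((a + μ_j) / σ_j) - Q(μ_j / σ_j))`. -/
def mixQDiff (m : ℕ) (σ a : ℝ) : ℝ :=
  ∑ j ∈ Finset.range (2 ^ m / 2),
    weight m j * (Q ((a + mean m σ j) / sd m σ j) - Q (mean m σ j / sd m σ j))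

/-- The map of one half-iteration of density evolution. The maxima come from
`P(l < -a, l < 0) = P(l < -max a 0)` for `a` the log ratio. -/
def g (C : Submodule (ZMod 2) (Fin n → ZMod 2)) (t m : ℕ) (σ x : ℝ) : ℝ :=
  fPe C t x * mixQ m σ (max (Real.log (fPe C t x / fQc C t x)) 0) +
  fPc C t x * mixQ m σ (max (Real.log (fPc C t x / fQe C t x)) 0) +
  fPeps C t x * mixQ m σ (max (Real.log (fPeps C t x / fQeps C t x)) 0) +
  fQe C t x * mixQDiff m σ (Real.log (fQe C t x / fPc C t x)) *
    Ubar (Real.log (fQe C t x / fPc C t x)) +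
  fQc C t x * mixQDiff m σ (Real.log (fQc C t x / fPe C t x)) *
    Ubar (Real.log (fQc C t x / fPe C t x)) +
  fQeps C t x * mixQDiff m σ (Real.log (fQeps C t x / fPeps C t x)) *
    Ubar (Real.log (fQeps C t x / fPeps C t x))

end

end IBDDCR

namespace IBDDCR

noncomputable section

open scoped Classical

/-! ### Rooted trees of sockets -/

/-! Write `n = k + 1`. After `d` half-iterations a message is a function of the `k`-ary tree of
depth `d` met when the graph is explored from its socket, and of the LLRs at the tree nodes
(`message_eq_treeMessage`). If the tree involves no constraint node twice, these LLRs are those of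
distinct variable nodes, hence independent, and the law of the message is computed by recursion
along the tree (`measureReal_treeMessage`). If moreover the sockets of the tree nodes were
independent and uniform, averaging over them would give exactly the recursion `evolve`
(`sum_treeProb`).

The explored tree is nearly such a uniform labelling. Fixing its `|Branch|` edges fixes that many
values of the permutation, and at least a fraction `N ^ (-|Branch|)` of all permutations of `N`
sockets has given values. So every labelling without coincidences is met with at least its uniform
probability, and as `K → ∞` such labellings make up almost all of them. This bounds the averaged law
from below by `evolve` up to `o(1)`, for each message value. Both laws have total mass one, so lower
bounds for all values force convergence (`tendsto_avgLaw`).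

It remains to compute one step of `evolve`. Translation by a codeword shows that `p(μ̄ | r, c = b)`
is the rate `outRate` for the all-zero codeword, with the received bit shifted by `b` and the output
sign flipped when `b = 1` (`outProb_eq_outRate`). Every mixture component has variance equal to
twice its mean, so `p(l | 0) = exp l * p(l | 1)`. Hence the soft value is `l` plus the logarithm of
a ratio of two rates (`softValue_eq`), and an erroneous outgoing message means that `l` lies in an
explicit interval, whose Gaussian mixture mass gives the terms of `g` (`halfStep_self`). The ratios
make sense because error probabilities stay in `(0, 1)` (`g_mem_Ioo`).

The decoder is tuned with the very limits to be found. This is not circular: the error probability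
after `d` steps involves only the parameters of earlier steps, so the limits exist by recursion and
are determined by uniqueness of limits. -/

/-- The branches of length between `1` and `d` starting at the root of the `k`-ary tree. -/
def Branch (k : ℕ) : ℕ → Type
  | 0 => Empty
  | d + 1 => Fin k × Option (Branch k d)

instance Branch.instFintype (k : ℕ) : ∀ d, Fintype (Branch k d)
  | 0 => inferInstanceAs (Fintype Empty)
  | d + 1 =>
    have := Branch.instFintype k d
    inferInstanceAs (Fintype (Fin k × Option (Branch k d)))

instance (k : ℕ) : IsEmpty (Branch k 0) := inferInstanceAs (IsEmpty Empty)

/-- The `k`-ary tree of depth `d`; the root is `none`. -/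
abbrev Node (k d : ℕ) := Option (Branch k d)

/-- The node of the tree of depth `d + 1` that is the node `o` of the subtree of the `i`-th child of
the root. -/
def Node.below {k d : ℕ} (i : Fin k) (o : Node k d) : Node k (d + 1) :=
  some ((i, o) : Fin k × Option (Branch k d))

theorem Node.below_inj {k d : ℕ} {i i' : Fin k} {o o' : Node k d} :
    Node.below i o = Node.below i' o' ↔ i = i' ∧ o = o' :=
  ⟨fun h => by
    have h' : ((i, o) : Fin k × Option (Branch k d)) = (i', o') := Option.some.inj h
    exact Prod.mk.inj h', fun ⟨h, h'⟩ => by rw [h, h']⟩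

/-- The labelling of the subtree of the `i`-th child of the root. -/
def subtree {k d : ℕ} {α : Type*} (W : Node k (d + 1) → α) (i : Fin k) : Node k d → α :=
  fun o => W (Node.below i o)

theorem Node.cases_succ {k d : ℕ} {P : Node k (d + 1) → Prop} (h0 : P none)
    (h : ∀ i (o : Node k d), P (Node.below i o)) : ∀ c, P c
  | none => h0
  | some c => h c.1 c.2

variable {k K : ℕ}

/-- The `i`-th of the other sockets of the node to which the socket `s` belongs. -/
def sibling (s : Socket K (k + 1)) (i : Fin k) : Socket K (k + 1) := (s.1, s.2.succAbove i)

variable {Λ B : Type*}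

/-- The message sent after `d` steps by the constraint node of socket `s`, for the interleaver `f`
from its side to the other side, and the labels `l` of the sockets of its side. -/
def message (cn : ℕ → Fin (k + 1) → (Fin k → B) → Λ → B) (h : Λ → B) :
    ℕ → Equiv.Perm (Socket K (k + 1)) → (Socket K (k + 1) → Λ) → Socket K (k + 1) → B
  | 0, _, l, s => h (l s)
  | d + 1, f, l, s =>
    cn d s.2 (fun i => message cn h d f.symm (l ∘ f.symm) (f (sibling s i))) (l s)

/-- The message arriving at the root of a tree with labels `L`, whose nodes have the sockets `W`. -/
def treeMessage (cn : ℕ → Fin (k + 1) → (Fin k → B) → Λ → B) (h : Λ → B) :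
    ∀ d, (Node k d → Socket K (k + 1)) → (Node k d → Λ) → B
  | 0, _, L => h (L none)
  | d + 1, W, L =>
    cn d (W none).2 (fun i => treeMessage cn h d (subtree W i) (subtree L i)) (L none)

/-- The sockets met when the graph with interleaver `f` is explored from socket `s`. -/
def explore : ∀ d, Equiv.Perm (Socket K (k + 1)) → Socket K (k + 1) → Node k d → Socket K (k + 1)
  | 0, _, s => fun _ => s
  | d + 1, f, s => fun o => o.elim s fun c : Fin k × Option (Branch k d) =>
      explore d f.symm (f (sibling s c.1)) c.2

@[simp]
theorem explore_none (d : ℕ) (f : Equiv.Perm (Socket K (k + 1))) (s : Socket K (k + 1)) :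
    explore d f s none = s := by
  cases d <;> rfl

theorem subtree_explore (d : ℕ) (f : Equiv.Perm (Socket K (k + 1))) (s : Socket K (k + 1))
    (i : Fin k) : subtree (explore (d + 1) f s) i = explore d f.symm (f (sibling s i)) := rfl

/-- The two ends of the edge revealed with a branch: the socket on the side of the root and the
socket on the other side. -/
def ends : ∀ d, (Node k d → Socket K (k + 1)) → Branch k d → Socket K (k + 1) × Socket K (k + 1)
  | 0, _ => fun c => c.elim
  | d + 1, W => fun c : Fin k × Option (Branch k d) =>
      c.2.elim (sibling (W none) c.1, subtree W c.1 none) fun c' => (ends d (subtree W c.1) c').swap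

/-- The socket, on the side of the root, of the variable node that a tree node stands for. -/
def rootSide {d : ℕ} (W : Node k d → Socket K (k + 1)) (o : Node k d) : Socket K (k + 1) :=
  o.elim (W none) fun c => (ends d W c).1

theorem apply_ends_explore (d : ℕ) : ∀ (f : Equiv.Perm (Socket K (k + 1))) (s : Socket K (k + 1))
    (c : Branch k d), f (ends d (explore d f s) c).1 = (ends d (explore d f s) c).2 := by
  induction d with
  | zero => exact fun _ _ c => c.elim
  | succ d ih =>
    intro f s c
    obtain ⟨i, _ | c⟩ := c
    · simp only [ends, Option.elim, subtree_explore, explore_none]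
    · have := ih f.symm (f (sibling s i)) c
      simp only [ends, Option.elim, subtree_explore, Prod.fst_swap, Prod.snd_swap]
      rw [← this, Equiv.apply_symm_apply]

/-- Together with `apply_ends_explore`, this says that exploration yields `W` exactly when the
permutation takes the values that the edges of `W` prescribe. Counting graphs with a given tree thus
becomes counting permutations with prescribed values. -/
theorem explore_eq_of_apply_ends (d : ℕ) : ∀ (f : Equiv.Perm (Socket K (k + 1)))
    (W : Node k d → Socket K (k + 1)), (∀ c, f (ends d W c).1 = (ends d W c).2) →
    explore d f (W none) = W := by
  induction d with
  | zero =>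
    intro f W _
    funext o
    obtain _ | c := o
    · rfl
    · exact c.elim
  | succ d ih =>
    intro f W hW
    have h1 (i : Fin k) : f (sibling (W none) i) = subtree W i none :=
      hW ((i, none) : Fin k × Option (Branch k d))
    have h2 (i : Fin k) : explore d f.symm (subtree W i none) = subtree W i := by
      refine ih _ _ fun c => ?_
      rw [Equiv.symm_apply_eq]
      exact (hW ((i, some c) : Fin k × Option (Branch k d))).symm
    funext o
    refine Node.cases_succ (P := fun o => explore (d + 1) f (W none) o = W o) rfl ?_ o
    intro i o
    change subtree (explore (d + 1) f (W none)) i o = subtree W i o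
    rw [subtree_explore, h1, h2]

/-- This separates the two sources of randomness: the interleaver enters only through the explored
tree, the LLRs only through the labels of its nodes. -/
theorem message_eq_treeMessage (cn : ℕ → Fin (k + 1) → (Fin k → B) → Λ → B) (h : Λ → B) (d : ℕ) :
    ∀ (f : Equiv.Perm (Socket K (k + 1))) (l : Socket K (k + 1) → Λ) (s : Socket K (k + 1)),
      message cn h d f l s =
        treeMessage cn h d (explore d f s) fun o => l (rootSide (explore d f s) o) := by
  induction d with
  | zero => exact fun _ _ _ => rfl
  | succ d ih =>
    intro f l s
    simp only [message, treeMessage, explore_none, rootSide, Option.elim]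
    congr 1
    funext i
    rw [ih, subtree_explore]
    congr 1
    funext o
    obtain _ | c := o
    · simp only [rootSide, Option.elim, explore_none, Function.comp, Equiv.symm_apply_apply, subtree,
        Node.below, ends]
    -- The subtree sees the labels `l ∘ f.symm` from the other side; `f.symm` carries an end on that
    -- side to the end on the side of the root, which is what the swap in `ends` records.
    · have h1 := apply_ends_explore d f.symm (f (sibling s i)) c
      simp only [rootSide, Option.elim, Function.comp, subtree, Node.below, ends]
      rw [h1]
      rfl

/-! ### Trees without coincidences -/

/-- The sockets of the tree nodes belong to distinct constraint nodes. -/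
def Spread {d : ℕ} (W : Node k d → Socket K (k + 1)) : Prop :=
  Function.Injective fun o => (W o).1

theorem Spread.subtree {d : ℕ} {W : Node k (d + 1) → Socket K (k + 1)} (hW : Spread W) (i : Fin k) :
    Spread (subtree W i) := fun o o' h => by
  exact (Node.below_inj.1 (hW h)).2

theorem ends_mem (d : ℕ) : ∀ (W : Node k d → Socket K (k + 1)) (c : Branch k d),
    (∃ o, (W o).1 = (ends d W c).1.1) ∧ ∃ o, (W o).1 = (ends d W c).2.1 := by
  induction d with
  | zero => exact fun _ c => c.elim
  | succ d ih =>
    intro W c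
    obtain ⟨i, _ | c⟩ := c
    · exact ⟨⟨none, rfl⟩, ⟨Node.below i none, rfl⟩⟩
    · obtain ⟨⟨o, ho⟩, ⟨o', ho'⟩⟩ := ih (subtree W i) c
      exact ⟨⟨Node.below i o', ho'⟩, ⟨Node.below i o, ho⟩⟩

theorem Spread.subtree_ne {d : ℕ} {W : Node k (d + 1) → Socket K (k + 1)} (hW : Spread W)
    {i i' : Fin k} (h : i ≠ i') (o o' : Node k d) :
    (IBDDCR.subtree W i o).1 ≠ (IBDDCR.subtree W i' o').1 := fun e => by
  exact h (Node.below_inj.1 (hW e)).1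

theorem Spread.root_ne {d : ℕ} {W : Node k (d + 1) → Socket K (k + 1)} (hW : Spread W)
    (i : Fin k) (o : Node k d) : (IBDDCR.subtree W i o).1 ≠ (W none).1 := fun e => by
  have := hW e
  simp [Node.below] at this

theorem sibling_ne (s : Socket K (k + 1)) (i : Fin k) : sibling s i ≠ s := fun h =>
  Fin.succAbove_ne s.2 i (congrArg Prod.snd h)

theorem sibling_injective (s : Socket K (k + 1)) : Function.Injective (sibling s) := fun _ _ h =>
  Fin.succAbove_right_injective (congrArg Prod.snd h)

/-- Both ends of a revealed edge lie at constraint nodes of the tree (`ends_mem`), so edges in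
different subtrees cannot meet. Passing to a subtree swaps the two sides, hence injectivity on both
sides must be proved together; the third claim handles an edge against the one leading to its own
subtree. `Spread` compares indices across both sides, which is more than needed but costs nothing in
the limit. -/
theorem Spread.ends_injective (d : ℕ) : ∀ W : Node k d → Socket K (k + 1), Spread W →
    (Function.Injective fun c => (ends d W c).1) ∧ (Function.Injective fun c => (ends d W c).2) ∧
      ∀ c, (ends d W c).1 ≠ W none := by
  induction d with
  | zero => exact fun _ _ => ⟨fun c => c.elim, fun c => c.elim, fun c => c.elim⟩
  | succ d ih =>
    intro W hW
    have key (i : Fin k) := ih (IBDDCR.subtree W i) (hW.subtree i)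
    have m1 (i : Fin k) (c : Branch k d) := (ends_mem d (IBDDCR.subtree W i) c).1
    have m2 (i : Fin k) (c : Branch k d) := (ends_mem d (IBDDCR.subtree W i) c).2
    refine ⟨?_, ?_, ?_⟩
    · rintro ⟨i, _ | c⟩ ⟨i', _ | c'⟩ h
      · obtain rfl : i = i' := sibling_injective _ h
        rfl
      · obtain ⟨o, ho⟩ := m2 i' c'
        refine absurd (ho.trans ?_) (hW.root_ne i' o)
        exact (congrArg Prod.fst h).symm
      · obtain ⟨o, ho⟩ := m2 i c
        exact absurd (ho.trans (congrArg Prod.fst h)) (hW.root_ne i o)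
      · obtain rfl | hi := eq_or_ne i i'
        · obtain rfl : c = c' := (key i).2.1 h
          rfl
        · obtain ⟨o, ho⟩ := m2 i c
          obtain ⟨o', ho'⟩ := m2 i' c'
          exact absurd (ho.trans ((congrArg Prod.fst h).trans ho'.symm)) (hW.subtree_ne hi o o')
    · rintro ⟨i, _ | c⟩ ⟨i', _ | c'⟩ h
      · obtain rfl | hi := eq_or_ne i i'
        · rfl
        · exact absurd (congrArg Prod.fst h) (hW.subtree_ne hi none none)
      · obtain rfl | hi := eq_or_ne i i'
        · exact absurd h.symm ((key i).2.2 c')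
        · obtain ⟨o', ho'⟩ := m1 i' c'
          exact absurd ((congrArg Prod.fst h).trans ho'.symm) (hW.subtree_ne hi none o')
      · obtain rfl | hi := eq_or_ne i i'
        · exact absurd h ((key i).2.2 c)
        · obtain ⟨o, ho⟩ := m1 i c
          exact absurd (ho.trans (congrArg Prod.fst h)) (hW.subtree_ne hi o none)
      · obtain rfl | hi := eq_or_ne i i'
        · obtain rfl : c = c' := (key i).1 h
          rfl
        · obtain ⟨o, ho⟩ := m1 i c
          obtain ⟨o', ho'⟩ := m1 i' c'
          exact absurd (ho.trans ((congrArg Prod.fst h).trans ho'.symm)) (hW.subtree_ne hi o o')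
    · rintro ⟨i, _ | c⟩ h
      · exact sibling_ne _ _ h
      · obtain ⟨o, ho⟩ := m2 i c
        exact hW.root_ne i o (ho.trans (congrArg Prod.fst h))

/-- Distinct tree nodes stand for distinct variable nodes, which is what makes their LLRs
independent. -/
theorem Spread.rootSide_injective {d : ℕ} {W : Node k d → Socket K (k + 1)} (hW : Spread W) :
    Function.Injective (rootSide W) := by
  obtain ⟨h1, -, h3⟩ := Spread.ends_injective d W hW
  rintro (_ | c) (_ | c') h
  · rfl
  · exact absurd h.symm (h3 c')
  · exact absurd h (h3 c)
  · rw [h1 h]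

/-! ### Counting interleavers -/

/-- At least a fraction `1 / N ^ |ι|` of the permutations of `N` objects has `|ι|` prescribed
values. -/
theorem factorial_le_card_perm_prescribed {ι α : Type*} [Fintype ι] [Fintype α] [DecidableEq α] (a b : ι → α)
    (ha : Function.Injective a) (hb : Function.Injective b) :
    Fintype.card (Equiv.Perm α) ≤
      Fintype.card {f : Equiv.Perm α // ∀ i, f (a i) = b i} * Fintype.card α ^ Fintype.card ι := by
  have h1 : Fintype.card (Equiv.Perm α) =
      ∑ b' : ι → α, Fintype.card {f : Equiv.Perm α // ∀ i, f (a i) = b' i} := by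
    simp only [Fintype.card_subtype, Finset.card_filter]
    rw [Finset.sum_comm]
    simp [← funext_iff (f := fun i => _)]
  -- The permutations are partitioned by their values `b'` on `a`. Injective `b'` all give classes
  -- of the same size, by composing with a permutation that carries `b'` to `b`, and the other
  -- classes are empty. So the class of `b` has at least the average size.
  have h2 (b' : ι → α) : Fintype.card {f : Equiv.Perm α // ∀ i, f (a i) = b' i} ≤
      Fintype.card {f : Equiv.Perm α // ∀ i, f (a i) = b i} := by
    by_cases hb' : Function.Injective b'
    · obtain ⟨τ, hτ⟩ := Equiv.Perm.exists_extending_pair b' b hb' hb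
      refine Fintype.card_le_of_injective
        (fun f => ⟨f.1.trans τ, fun i => ?_⟩) fun f g h => ?_
      · simp [f.2 i, hτ i]
      · have := congrArg Subtype.val h
        ext x
        have := congrArg (fun e => e x) this
        simpa using this
    · have : IsEmpty {f : Equiv.Perm α // ∀ i, f (a i) = b' i} := by
        refine ⟨fun f => hb' fun i j hij => ha (f.1.injective ?_)⟩
        rw [f.2 i, f.2 j, hij]
      simp
  rw [h1]
  refine (Finset.sum_le_card_nsmul _ _ _ fun b' _ => h2 b').trans ?_
  rw [Finset.card_univ, Fintype.card_fun, smul_eq_mul, mul_comm]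

theorem card_spread (d : ℕ) :
    Fintype.card {W : Node k d → Socket K (k + 1) // Spread W} =
      K.descFactorial (Fintype.card (Node k d)) * (k + 1) ^ Fintype.card (Node k d) := by
  have e : {W : Node k d → Socket K (k + 1) // Spread W} ≃
      (Node k d ↪ Fin K) × (Node k d → Fin (k + 1)) :=
    { toFun := fun W => (⟨fun o => (W.1 o).1, W.2⟩, fun o => (W.1 o).2)
      invFun := fun p => ⟨fun o => (p.1 o, p.2 o), p.1.injective⟩
      left_inv := fun _ => rfl
      right_inv := fun _ => rfl }
  rw [Fintype.card_congr e, Fintype.card_prod, Fintype.card_embedding_eq, Fintype.card_fun,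
    Fintype.card_fin, Fintype.card_fin]

/-- With `R` tree nodes the ratio is the falling factorial of `K` of length `R` over `K ^ R`,
squeezed between `(1 - R / K) ^ R` and `1`; the positions inside the constraint nodes cancel. -/
theorem tendsto_card_spread (k d : ℕ) :
    Tendsto (fun K : ℕ => (Fintype.card {W : Node k d → Socket K (k + 1) // Spread W} : ℝ) /
      Fintype.card (Node k d → Socket K (k + 1))) atTop (𝓝 1) := by
  set R := Fintype.card (Node k d) with hR
  have h0 : Tendsto (fun K : ℕ => (1 - R / (K : ℝ)) ^ R) atTop (𝓝 1) := by
    have := ((tendsto_const_div_atTop_nhds_zero_nat (R : ℝ)).const_sub 1).pow R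
    simpa using this
  refine tendsto_of_tendsto_of_tendsto_of_le_of_le' h0 tendsto_const_nhds ?_ ?_
  · filter_upwards [eventually_ge_atTop (R + 1)] with K hK
    have hK0 : (0 : ℝ) < K := by exact_mod_cast (by omega : 0 < K)
    rw [card_spread, Fintype.card_fun, Fintype.card_prod, Fintype.card_fin, Fintype.card_fin,
      ← hR]
    push_cast
    rw [mul_pow, mul_div_mul_right _ _ (by positivity), le_div_iff₀ (by positivity), ← mul_pow,
      sub_mul, div_mul_cancel₀ _ hK0.ne', one_mul]
    calc ((K : ℝ) - R) ^ R ≤ ((K + 1 - R : ℕ) : ℝ) ^ R := by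
          have h1 : (R : ℝ) + 1 ≤ K := by exact_mod_cast hK
          rw [Nat.cast_sub (by omega)]
          refine pow_le_pow_left₀ (by linarith) ?_ _
          push_cast
          linarith
      _ ≤ _ := by exact_mod_cast Nat.pow_sub_le_descFactorial K R
  · filter_upwards with K
    refine div_le_one_of_le₀ ?_ (by positivity)
    exact_mod_cast Fintype.card_subtype_le _

end

noncomputable section

open scoped Classical

variable {k K : ℕ} {Λ B : Type*} [MeasurableSpace Λ] [Fintype B]

/-! ### The law of a message on a tree -/

/-- The law of the tree message, for fixed sockets and independent labels of law `μ`. -/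
def treeProb (μ : Measure Λ) (cn : ℕ → Fin (k + 1) → (Fin k → B) → Λ → B) (h : Λ → B) :
    ∀ d, (Node k d → Socket K (k + 1)) → B → ℝ
  | 0, _, b => μ.real {x | h x = b}
  | d + 1, W, b => ∑ e : Fin k → B,
      μ.real {x | cn d (W none).2 e x = b} * ∏ i, treeProb μ cn h d (subtree W i) (e i)

/-- The law of the message after `d` steps of density evolution. -/
def evolve (μ : Measure Λ) (cn : ℕ → Fin (k + 1) → (Fin k → B) → Λ → B) (h : Λ → B) :
    ℕ → B → ℝ
  | 0, b => μ.real {x | h x = b}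
  | d + 1, b => (∑ j : Fin (k + 1), ∑ e : Fin k → B,
      μ.real {x | cn d j e x = b} * ∏ i, evolve μ cn h d (e i)) / (k + 1)

theorem map_option_prod_pi {ι κ : Type*} [Fintype ι] [Fintype κ] (μ : Measure Λ) [SigmaFinite μ] :
    MeasurePreserving (fun (z : Λ × (ι → κ → Λ)) (o : Option (ι × κ)) =>
        o.elim z.1 fun p => z.2 p.1 p.2)
      (μ.prod (Measure.pi fun _ => Measure.pi fun _ => μ)) (Measure.pi fun _ => μ) := by
  have hm : Measurable (fun (z : Λ × (ι → κ → Λ)) (o : Option (ι × κ)) =>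
      o.elim z.1 fun p => z.2 p.1 p.2) := by
    refine measurable_pi_lambda _ fun o => ?_
    obtain _ | ⟨i, c⟩ := o
    · exact measurable_fst
    · exact (measurable_pi_apply c).comp ((measurable_pi_apply i).comp measurable_snd)
  refine ⟨hm, (Measure.pi_eq fun s hs => ?_).symm⟩
  rw [Measure.map_apply hm (MeasurableSet.univ_pi hs)]
  have : (fun (z : Λ × (ι → κ → Λ)) (o : Option (ι × κ)) => o.elim z.1 fun p => z.2 p.1 p.2) ⁻¹'
      Set.univ.pi s = s none ×ˢ Set.univ.pi fun i => Set.univ.pi fun c => s (some (i, c)) := by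
    ext z
    simp [Option.forall]
  rw [this, Measure.prod_prod, Measure.pi_pi]
  simp_rw [Measure.pi_pi]
  rw [Fintype.prod_option, Fintype.prod_prod_type]

/-- The labelling of a tree with given label of the root and given labels of the subtrees. -/
def graft {α : Type*} {d : ℕ} (x : α) (L : Fin k → Node k d → α) : Node k (d + 1) → α :=
  fun o => o.elim x fun c : Fin k × Node k d => L c.1 c.2

theorem measurePreserving_graft (d : ℕ) (μ : Measure Λ) [SigmaFinite μ] :
    MeasurePreserving (fun z : Λ × (Fin k → Node k d → Λ) => graft z.1 z.2)
      (μ.prod (Measure.pi fun _ => Measure.pi fun _ => μ)) (Measure.pi fun _ => μ) :=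
  map_option_prod_pi μ

theorem measurableSet_treeMessage {cn : ℕ → Fin (k + 1) → (Fin k → B) → Λ → B} {h : Λ → B}
    (hcn : ∀ d j e b, MeasurableSet {x | cn d j e x = b}) (hh : ∀ b, MeasurableSet {x | h x = b})
    (d : ℕ) : ∀ (W : Node k d → Socket K (k + 1)) (b : B),
      MeasurableSet {L | treeMessage cn h d W L = b} := by
  induction d with
  | zero => exact fun W b => measurable_pi_apply (X := fun _ : Node k 0 => Λ) none (hh b)
  | succ d ih =>
    intro W b
    have : {L | treeMessage cn h (d + 1) W L = b} = ⋃ e : Fin k → B,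
        {L | cn d (W none).2 e (L none) = b} ∩
          ⋂ i, (fun L => subtree L i) ⁻¹' {L | treeMessage cn h d (subtree W i) L = e i} := by
      ext L
      simp only [treeMessage, Set.mem_ofPred_eq, Set.mem_iUnion, Set.mem_inter_iff, Set.mem_iInter,
        Set.mem_preimage]
      refine ⟨fun h => ⟨_, h, fun i => rfl⟩, ?_⟩
      rintro ⟨e, h1, h2⟩
      rw [← h1]
      congr 1
      exact funext h2
    rw [this]
    refine MeasurableSet.iUnion fun e => MeasurableSet.inter
      (measurable_pi_apply (X := fun _ : Node k (d + 1) => Λ) none (hcn d _ e b))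
      (MeasurableSet.iInter fun i => ?_)
    exact (measurable_pi_lambda _ fun o => measurable_pi_apply _) (ih _ _)

/-- The root label and the labels of the `k` subtrees are independent. Splitting by the vector `e`
of messages that arrive at the root gives the product in `treeProb`. -/
theorem measureReal_treeMessage {μ : Measure Λ} [IsProbabilityMeasure μ]
    {cn : ℕ → Fin (k + 1) → (Fin k → B) → Λ → B} {h : Λ → B}
    (hcn : ∀ d j e b, MeasurableSet {x | cn d j e x = b}) (hh : ∀ b, MeasurableSet {x | h x = b})
    (d : ℕ) : ∀ (W : Node k d → Socket K (k + 1)) (b : B),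
      (Measure.pi fun _ : Node k d => μ).real {L | treeMessage cn h d W L = b} =
        treeProb μ cn h d W b := by
  induction d with
  | zero =>
    intro W b
    exact (measurePreserving_eval (fun _ : Node k 0 => μ) none).measureReal_preimage
      (hh b).nullMeasurableSet
  | succ d ih =>
    intro W b
    rw [treeProb, ← (measurePreserving_graft d μ).measureReal_preimage
      (measurableSet_treeMessage hcn hh (d + 1) W b).nullMeasurableSet]
    have : (fun z : Λ × (Fin k → Node k d → Λ) => graft z.1 z.2) ⁻¹'
          {L | treeMessage cn h (d + 1) W L = b} =
        ⋃ e ∈ (Finset.univ : Finset (Fin k → B)), {x | cn d (W none).2 e x = b} ×ˢ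
          Set.univ.pi fun i => {L | treeMessage cn h d (subtree W i) L = e i} := by
      ext z
      simp only [Set.mem_preimage, Set.mem_ofPred_eq, Set.mem_iUnion, Finset.mem_univ, Set.mem_prod,
        Set.mem_univ_pi, exists_prop, true_and]
      refine ⟨fun h => ⟨_, h, fun i => rfl⟩, ?_⟩
      rintro ⟨e, h1, h2⟩
      rw [← h1]
      change cn d (W none).2 (fun i => treeMessage cn h d (subtree W i) (z.2 i)) z.1 = _
      congr 1
      exact funext h2
    rw [this, measureReal_biUnion_finset]
    · refine Finset.sum_congr rfl fun e _ => ?_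
      rw [measureReal_prod_prod, measureReal_def, measureReal_def, Measure.pi_pi,
        ENNReal.toReal_prod]
      simp_rw [← ih]
      rfl
    · intro e _ e' _ hne
      refine Set.disjoint_left.2 fun z hz hz' => hne ?_
      funext i
      exact (hz.2 i trivial).symm.trans (hz'.2 i trivial)
    · exact fun e _ => (hcn _ _ _ _).prod (MeasurableSet.univ_pi fun i =>
        measurableSet_treeMessage hcn hh d _ _)

theorem treeProb_nonneg (μ : Measure Λ) (cn : ℕ → Fin (k + 1) → (Fin k → B) → Λ → B) (h : Λ → B)
    (d : ℕ) : ∀ (W : Node k d → Socket K (k + 1)) (b : B), 0 ≤ treeProb μ cn h d W b := by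
  induction d with
  | zero => exact fun _ _ => measureReal_nonneg
  | succ d ih =>
    exact fun _ _ => Finset.sum_nonneg fun _ _ => mul_nonneg measureReal_nonneg (Finset.prod_nonneg fun _ _ => ih _ _)

/-- A uniform labelling consists of a uniform root and `k` independent uniform labellings of the
subtrees. The sum over labellings therefore factors along the tree, and only the position of the
root socket remains to be averaged. -/
theorem sum_treeProb {μ : Measure Λ} {cn : ℕ → Fin (k + 1) → (Fin k → B) → Λ → B} {h : Λ → B}
    (d : ℕ) : ∀ b, ∑ W : Node k d → Socket K (k + 1), treeProb μ cn h d W b =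
      Fintype.card (Node k d → Socket K (k + 1)) * evolve μ cn h d b := by
  induction d with
  | zero => simp [treeProb, evolve]
  | succ d ih =>
    intro b
    let e : Socket K (k + 1) × (Fin k → Node k d → Socket K (k + 1)) ≃
        (Node k (d + 1) → Socket K (k + 1)) :=
      { toFun := fun z => graft z.1 z.2
        invFun := fun W => (W none, subtree W)
        left_inv := fun _ => rfl
        right_inv := fun W => funext fun o =>
          Node.cases_succ (P := fun o => graft (W none) (subtree W) o = W o) rfl
            (fun _ _ => rfl) o }
    have hs (z : Socket K (k + 1) × (Fin k → Node k d → Socket K (k + 1))) :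
        treeProb μ cn h (d + 1) (e z) b =
          ∑ c : Fin k → B, μ.real {x | cn d z.1.2 c x = b} * ∏ i, treeProb μ cn h d (z.2 i) (c i) :=
      rfl
    have hprod (c : Fin k → B) : ∑ L : Fin k → Node k d → Socket K (k + 1),
        ∏ i, treeProb μ cn h d (L i) (c i) = ∏ i, ∑ W : Node k d → Socket K (k + 1), treeProb μ cn h d W (c i) := by
      rw [Finset.prod_univ_sum, Fintype.piFinset_univ]
    have hcard : (Fintype.card (Node k (d + 1) → Socket K (k + 1)) : ℝ) =
        K * (k + 1) * (Fintype.card (Node k d → Socket K (k + 1)) : ℝ) ^ k := by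
      rw [← Fintype.card_congr e]
      simp
    rw [← e.sum_comp, hcard, Fintype.sum_prod_type]
    simp_rw [hs]
    have hk : (k + 1 : ℝ) ≠ 0 := by positivity
    have h1 (s : Socket K (k + 1)) : ∑ L : Fin k → Node k d → Socket K (k + 1),
        ∑ c : Fin k → B, μ.real {x | cn d s.2 c x = b} * ∏ i, treeProb μ cn h d (L i) (c i) =
        (Fintype.card (Node k d → Socket K (k + 1)) : ℝ) ^ k *
          ∑ c : Fin k → B, μ.real {x | cn d s.2 c x = b} * ∏ i, evolve μ cn h d (c i) := by
      rw [Finset.sum_comm, Finset.mul_sum]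
      refine Finset.sum_congr rfl fun c _ => ?_
      rw [← Finset.mul_sum, hprod]
      simp_rw [ih]
      rw [Finset.prod_mul_distrib, Finset.prod_const, Finset.card_univ, Fintype.card_fin]
      ring
    simp_rw [h1]
    rw [← Finset.mul_sum, Fintype.sum_prod_type, evolve]
    simp only [Finset.sum_const, Finset.card_univ, Fintype.card_fin, nsmul_eq_mul]
    field_simp

/-! ### The limit of infinite block length -/

theorem sum_measureReal_eq_one {μ : Measure Λ} [IsProbabilityMeasure μ] {φ : Λ → B}
    (hφ : ∀ b, MeasurableSet {x | φ x = b}) : ∑ b, μ.real {x | φ x = b} = 1 := by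
  rw [← measureReal_biUnion_finset (fun b _ b' _ hb => Set.disjoint_left.2 fun x h h' =>
    hb (h.symm.trans h')) fun b _ => hφ b]
  convert probReal_univ (μ := μ) using 2
  ext x
  simp

theorem sum_evolve {μ : Measure Λ} [IsProbabilityMeasure μ]
    {cn : ℕ → Fin (k + 1) → (Fin k → B) → Λ → B} {h : Λ → B}
    (hcn : ∀ d j e b, MeasurableSet {x | cn d j e x = b}) (hh : ∀ b, MeasurableSet {x | h x = b})
    (d : ℕ) : ∑ b, evolve μ cn h d b = 1 := by
  induction d with
  | zero => exact sum_measureReal_eq_one hh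
  | succ d ih =>
    have h1 : ∑ e : Fin k → B, ∏ i, evolve μ cn h d (e i) = 1 := by
      have := Finset.prod_univ_sum (fun _ : Fin k => (Finset.univ : Finset B))
        fun _ => evolve μ cn h d
      rw [Fintype.piFinset_univ, ih, Finset.prod_const_one] at this
      exact this.symm
    simp only [evolve]
    rw [← Finset.sum_div, Finset.sum_comm]
    have h2 (j : Fin (k + 1)) : ∑ b, ∑ e : Fin k → B,
        μ.real {x | cn d j e x = b} * ∏ i, evolve μ cn h d (e i) = 1 := by
      rw [Finset.sum_comm, ← h1]
      refine Finset.sum_congr rfl fun e _ => ?_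
      rw [← Finset.sum_mul, sum_measureReal_eq_one (hcn d j e), one_mul]
    simp_rw [h2]
    have hk : (k + 1 : ℝ) ≠ 0 := by positivity
    simp [hk]

theorem measurePreserving_comp_injective {ι α : Type*} [Fintype ι] [Fintype α] (μ : Measure Λ)
    [IsProbabilityMeasure μ] {a : ι → α} (ha : Function.Injective a) :
    MeasurePreserving (fun (l : α → Λ) i => l (a i)) (Measure.pi fun _ => μ)
      (Measure.pi fun _ => μ) := by
  refine ⟨measurable_pi_lambda _ fun i => measurable_pi_apply _, ?_⟩
  have h1 : iIndepFun (fun (x : α) (l : α → Λ) => l x) (Measure.pi fun _ => μ) :=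
    iIndepFun_pi (X := fun _ => id) fun _ => aemeasurable_id
  have h2 := h1.precomp ha
  rw [iIndepFun_iff_map_fun_eq_pi_map fun i => (measurable_pi_apply _).aemeasurable] at h2
  refine h2.trans ?_
  congr 1
  funext i
  exact (measurePreserving_eval (fun _ : α => μ) (a i)).map_eq

/-- The law of a message, averaged over the ensemble. -/
def avgLaw (μ : Measure Λ) (cn : ℕ → Fin (k + 1) → (Fin k → B) → Λ → B) (h : Λ → B) (d K : ℕ)
    (b : B) : ℝ :=
  (∑ f : Equiv.Perm (Socket K (k + 1)), ∑ s : Socket K (k + 1),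
      (Measure.pi fun _ : Socket K (k + 1) => μ).real {l | message cn h d f l s = b}) /
    (Fintype.card (Equiv.Perm (Socket K (k + 1))) * Fintype.card (Socket K (k + 1)))

section

variable {μ : Measure Λ} [IsProbabilityMeasure μ] {cn : ℕ → Fin (k + 1) → (Fin k → B) → Λ → B}
  {h : Λ → B} (hcn : ∀ d j e b, MeasurableSet {x | cn d j e x = b})
  (hh : ∀ b, MeasurableSet {x | h x = b})

include hcn hh

theorem measurableSet_message (d : ℕ) (f : Equiv.Perm (Socket K (k + 1))) (s : Socket K (k + 1))
    (b : B) : MeasurableSet {l : Socket K (k + 1) → Λ | message cn h d f l s = b} := by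
  simp_rw [message_eq_treeMessage]
  exact (measurable_pi_lambda (fun (l : Socket K (k + 1) → Λ) o =>
    l (rootSide (explore d f s) o)) fun o => measurable_pi_apply _)
      (measurableSet_treeMessage hcn hh d _ b)

theorem measureReal_message_of_spread (d : ℕ) (f : Equiv.Perm (Socket K (k + 1)))
    (s : Socket K (k + 1)) (hs : Spread (explore d f s)) (b : B) :
    (Measure.pi fun _ : Socket K (k + 1) => μ).real {l | message cn h d f l s = b} =
      treeProb μ cn h d (explore d f s) b := by
  simp_rw [message_eq_treeMessage]
  rw [← measureReal_treeMessage hcn hh d (explore d f s) b]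
  exact (measurePreserving_comp_injective μ hs.rootSide_injective).measureReal_preimage
    (measurableSet_treeMessage hcn hh d _ b).nullMeasurableSet

theorem treeProb_le_one (d : ℕ) (W : Node k d → Socket K (k + 1)) (b : B) :
    treeProb μ cn h d W b ≤ 1 := by
  rw [← measureReal_treeMessage hcn hh d W b]
  exact measureReal_le_one

omit hcn hh [IsProbabilityMeasure μ] in
theorem card_prescribed_le_card_explore (d : ℕ) (W : Node k d → Socket K (k + 1)) :
    Fintype.card {f : Equiv.Perm (Socket K (k + 1)) // ∀ c, f (ends d W c).1 = (ends d W c).2} ≤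
      Fintype.card {z : Equiv.Perm (Socket K (k + 1)) × Socket K (k + 1) //
        explore d z.1 z.2 = W} :=
  Fintype.card_le_of_injective
    (fun f => ⟨(f.1, W none), explore_eq_of_apply_ends d f.1 W f.2⟩) fun _ _ hfg =>
      Subtype.ext (congrArg (fun z => z.1.1) hfg)

/-- Pairs of interleaver and socket whose tree has coincidences are dropped. A `Spread` labelling
comes from at least its uniform share of the pairs, and the loss is at most the uniform fraction of
labellings that are not `Spread`, since `treeProb` is at most one. -/
theorem evolve_sub_le_avgLaw (d K : ℕ) (hK : 0 < K) (b : B) :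
    evolve μ cn h d b - (1 - (Fintype.card {W : Node k d → Socket K (k + 1) // Spread W} : ℝ) /
      Fintype.card (Node k d → Socket K (k + 1))) ≤ avgLaw μ cn h d K b := by
  set S := Socket K (k + 1)
  have : Nonempty S := ⟨(⟨0, hK⟩, 0)⟩
  have hN : (0 : ℝ) < Fintype.card S := by exact_mod_cast Fintype.card_pos
  have hP : (0 : ℝ) < Fintype.card (Equiv.Perm S) := by exact_mod_cast Fintype.card_pos
  have hT : (Fintype.card (Node k d → S) : ℝ) =
      (Fintype.card S : ℝ) ^ Fintype.card (Branch k d) * Fintype.card S := by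
    rw [Fintype.card_fun, Fintype.card_option, pow_succ]
    push_cast
    rfl
  have hT0 : (0 : ℝ) < Fintype.card (Node k d → S) := by rw [hT]; positivity
  have hcount (W : Node k d → S) (hW : Spread W) :
      (Fintype.card (Equiv.Perm S) : ℝ) / (Fintype.card S : ℝ) ^ Fintype.card (Branch k d) ≤
        Fintype.card {z : Equiv.Perm S × S // explore d z.1 z.2 = W} := by
    obtain ⟨h1, h2, -⟩ := Spread.ends_injective d W hW
    rw [div_le_iff₀ (by positivity)]
    have h3 : Fintype.card (Equiv.Perm S) ≤
        Fintype.card {f : Equiv.Perm S // ∀ c, f (ends d W c).1 = (ends d W c).2} *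
          Fintype.card S ^ Fintype.card (Branch k d) := by
      convert factorial_le_card_perm_prescribed _ _ h1 h2
    have h4 : Fintype.card {f : Equiv.Perm S // ∀ c, f (ends d W c).1 = (ends d W c).2} ≤
        Fintype.card {z : Equiv.Perm S × S // explore d z.1 z.2 = W} :=
      card_prescribed_le_card_explore d W
    exact_mod_cast h3.trans (Nat.mul_le_mul_right _ h4)
  have hlow : ∑ W : Node k d → S, (if Spread W then treeProb μ cn h d W b *
      Fintype.card {z : Equiv.Perm S × S // explore d z.1 z.2 = W} else 0) ≤
      ∑ f : Equiv.Perm S, ∑ s : S,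
        (Measure.pi fun _ : S => μ).real {l | message cn h d f l s = b} := by
    rw [← Fintype.sum_prod_type' (f := fun (f : Equiv.Perm S) (s : S) =>
      (Measure.pi fun _ : S => μ).real {l | message cn h d f l s = b})]
    calc _ = ∑ z : Equiv.Perm S × S, (if Spread (explore d z.1 z.2) then
          treeProb μ cn h d (explore d z.1 z.2) b else 0) := by
          rw [← Finset.sum_fiberwise (s := Finset.univ)
            (g := fun z : Equiv.Perm S × S => explore d z.1 z.2)]
          refine Finset.sum_congr rfl fun W _ => ?_
          rw [Finset.sum_congr rfl (g := fun _ => if Spread W then treeProb μ cn h d W b else 0)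
            (fun z hz => by rw [(Finset.mem_filter.1 hz).2]), Finset.sum_const,
            ← Fintype.card_subtype, nsmul_eq_mul]
          split_ifs <;> ring
      _ ≤ _ := by
          refine Finset.sum_le_sum fun z _ => ?_
          split_ifs with hz
          · exact (measureReal_message_of_spread hcn hh d z.1 z.2 hz b).ge
          · exact measureReal_nonneg
  have hmass : Fintype.card (Node k d → S) * evolve μ cn h d b -
      (Fintype.card (Node k d → S) - Fintype.card {W : Node k d → S // Spread W}) ≤
      ∑ W : Node k d → S, if Spread W then treeProb μ cn h d W b else 0 := by
    rw [← sum_treeProb, sub_le_iff_le_add]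
    have : (Fintype.card (Node k d → S) : ℝ) - Fintype.card {W : Node k d → S // Spread W} =
        ∑ W : Node k d → S, if Spread W then (0 : ℝ) else 1 := by
      have h1 : (Fintype.card (Node k d → S) : ℝ) = ∑ W : Node k d → S, (1 : ℝ) := by simp
      have h2 : (Fintype.card {W : Node k d → S // Spread W} : ℝ) =
          ∑ W : Node k d → S, if Spread W then (1 : ℝ) else 0 := by
        simp [Fintype.card_subtype]
      rw [h1, h2, ← Finset.sum_sub_distrib]
      refine Finset.sum_congr rfl fun W _ => ?_
      split_ifs <;> ring
    rw [this, ← Finset.sum_add_distrib]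
    refine Finset.sum_le_sum fun W _ => ?_
    split_ifs
    · rw [add_zero]
    · rw [zero_add]
      exact treeProb_le_one hcn hh d W b
  change _ ≤ (∑ f : Equiv.Perm S, ∑ s : S,
    (Measure.pi fun _ : S => μ).real {l | message cn h d f l s = b}) /
      ((Fintype.card (Equiv.Perm S) : ℝ) * Fintype.card S)
  rw [le_div_iff₀ (by positivity)]
  refine le_trans ?_ hlow
  calc _ = (Fintype.card (Node k d → S) * evolve μ cn h d b -
        (Fintype.card (Node k d → S) - Fintype.card {W : Node k d → S // Spread W})) *
        (Fintype.card (Equiv.Perm S) / (Fintype.card S : ℝ) ^ Fintype.card (Branch k d)) := by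
        rw [hT]
        field_simp
        rfl
    _ ≤ (∑ W : Node k d → S, if Spread W then treeProb μ cn h d W b else 0) *
        (Fintype.card (Equiv.Perm S) / (Fintype.card S : ℝ) ^ Fintype.card (Branch k d)) :=
        mul_le_mul_of_nonneg_right hmass (by positivity)
    _ ≤ _ := by
        rw [Finset.sum_mul]
        refine Finset.sum_le_sum fun W _ => ?_
        split_ifs with hW
        · exact mul_le_mul_of_nonneg_left (hcount W hW) (treeProb_nonneg _ _ _ _ _ _)
        · rw [zero_mul]

theorem sum_avgLaw (d K : ℕ) (hK : 0 < K) : ∑ b, avgLaw μ cn h d K b = 1 := by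
  have : Nonempty (Socket K (k + 1)) := ⟨(⟨0, hK⟩, 0)⟩
  have hN : (Fintype.card (Socket K (k + 1)) : ℝ) ≠ 0 := by exact_mod_cast Fintype.card_ne_zero
  have hP : (Fintype.card (Equiv.Perm (Socket K (k + 1))) : ℝ) ≠ 0 := by
    exact_mod_cast Fintype.card_ne_zero
  simp only [avgLaw]
  rw [← Finset.sum_div, Finset.sum_comm, div_eq_one_iff_eq (mul_ne_zero hP hN)]
  have h1 (f : Equiv.Perm (Socket K (k + 1))) : ∑ b, ∑ s : Socket K (k + 1),
      (Measure.pi fun _ : Socket K (k + 1) => μ).real {l | message cn h d f l s = b} =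
      Fintype.card (Socket K (k + 1)) := by
    rw [Finset.sum_comm]
    simp_rw [sum_measureReal_eq_one fun b => measurableSet_message hcn hh d f _ b]
    simp
  simp_rw [h1]
  simp

/-- Density evolution: in the limit of infinite block length, the ensemble average of the law of a
message follows the recursion for trees. -/
theorem tendsto_avgLaw (d : ℕ) (b : B) :
    Tendsto (fun K => avgLaw μ cn h d K b) atTop (𝓝 (evolve μ cn h d b)) := by
  set ε : ℕ → ℝ := fun K => 1 - (Fintype.card {W : Node k d → Socket K (k + 1) // Spread W} : ℝ) /
      Fintype.card (Node k d → Socket K (k + 1)) with hε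
  have h0 : Tendsto ε atTop (𝓝 0) := by
    rw [← sub_self (1 : ℝ)]
    exact (tendsto_card_spread k d).const_sub 1
  have hl : Tendsto (fun K => evolve μ cn h d b - ε K) atTop (𝓝 (evolve μ cn h d b)) := by
    simpa using h0.const_sub (evolve μ cn h d b)
  have hu : Tendsto (fun K => evolve μ cn h d b +
      ((Finset.univ.erase b).card : ℝ) * ε K) atTop (𝓝 (evolve μ cn h d b)) := by
    simpa using (h0.const_mul ((Finset.univ.erase b).card : ℝ)).const_add (evolve μ cn h d b)
  refine tendsto_of_tendsto_of_tendsto_of_le_of_le' hl hu ?_ ?_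
  · filter_upwards [eventually_gt_atTop 0] with K hK
    exact evolve_sub_le_avgLaw hcn hh d K hK b
  · filter_upwards [eventually_gt_atTop 0] with K hK
    -- The upper bound for `b` comes from the lower bounds for all other values, because both laws
    -- sum to one.
    have h1 := sum_avgLaw (μ := μ) hcn hh d K hK
    have h2 := sum_evolve (μ := μ) hcn hh d
    rw [← Finset.add_sum_erase _ _ (Finset.mem_univ b)] at h1 h2
    have h3 := Finset.sum_le_sum fun b' (_ : b' ∈ Finset.univ.erase b) =>
      evolve_sub_le_avgLaw (μ := μ) hcn hh d K hK b'
    rw [Finset.sum_sub_distrib, Finset.sum_const, nsmul_eq_mul] at h3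
    linarith

end

end

noncomputable section

open scoped Classical

/-! ### Bounded distance decoding -/

section Decoding

variable {n : ℕ} {C : Submodule (ZMod 2) (Fin n → ZMod 2)} {t : ℕ}

theorem ZMod.two_eq_zero_or_one (a : ZMod 2) : a = 0 ∨ a = 1 := by
  revert a; decide

theorem eq_of_hammingDist_le (ht : t = (minDist C - 1) / 2) {c c' w : Fin n → ZMod 2} (hc : c ∈ C)
    (hc' : c' ∈ C) (h : hammingDist c w ≤ t) (h' : hammingDist c' w ≤ t) : c = c' := by
  by_contra hne
  have hmem : hammingDist c c' ∈ {d | ∃ c ∈ C, ∃ c' ∈ C, c ≠ c' ∧ hammingDist c c' = d} :=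
    ⟨c, hc, c', hc', hne, rfl⟩
  have h1 : minDist C ≤ hammingDist c c' := Nat.sInf_le hmem
  -- Positivity guards against truncated subtraction: only then does `t = (minDist C - 1) / 2` give
  -- `2 * t < minDist C`.
  have h2 : 0 < minDist C := by
    obtain ⟨a, -, b, -, hab, hd⟩ := Nat.sInf_mem ⟨_, hmem⟩
    rw [minDist, ← hd]
    exact hammingDist_pos.2 hab
  have h3 := hammingDist_triangle_right c c' w
  omega

/-- Some codeword within distance `t` of `w` has the value `b` at position `j`. -/
def DecodesTo (C : Submodule (ZMod 2) (Fin n → ZMod 2)) (t : ℕ) (w : Fin n → ZMod 2) (j : Fin n)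
    (b : ZMod 2) : Prop :=
  ∃ c ∈ C, hammingDist c w ≤ t ∧ c j = b

theorem bddOut_eq (w : Fin n → ZMod 2) (j : Fin n) :
    bddOut C t w j = if DecodesTo C t w j 0 then 1 else if DecodesTo C t w j 1 then -1 else 0 := by
  unfold bddOut
  congr

theorem decodesTo_add {c : Fin n → ZMod 2} (hc : c ∈ C) (w : Fin n → ZMod 2) (j : Fin n)
    (b : ZMod 2) : DecodesTo C t (c + w) j b ↔ DecodesTo C t w j (b - c j) := by
  constructor
  · rintro ⟨c', hc', hd, hb⟩
    refine ⟨c' - c, C.sub_mem hc' hc, ?_, by simp [hb]⟩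
    rw [hammingDist_eq_hammingNorm] at hd ⊢
    rwa [show -(c' - c) + w = -c' + (c + w) by abel]
  · rintro ⟨c', hc', hd, hb⟩
    refine ⟨c' + c, C.add_mem hc' hc, ?_, by simp [hb]⟩
    rw [hammingDist_eq_hammingNorm] at hd ⊢
    rwa [show -(c' + c) + (c + w) = -c' + w by abel]

theorem bddOut_add_of_eq_zero {c : Fin n → ZMod 2} (hc : c ∈ C) {j : Fin n} (hj : c j = 0)
    (w : Fin n → ZMod 2) : bddOut C t (c + w) j = bddOut C t w j := by
  simp only [bddOut_eq, decodesTo_add hc, hj, sub_zero]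

/-- `bddOut` tests for the value `0` first, so it is odd under translation only because the two
tests never succeed together. This is where the unique decoding radius is needed. -/
theorem bddOut_add_of_eq_one (ht : t = (minDist C - 1) / 2) {c : Fin n → ZMod 2} (hc : c ∈ C)
    {j : Fin n} (hj : c j = 1) (w : Fin n → ZMod 2) :
    bddOut C t (c + w) j = -bddOut C t w j := by
  have h01 : ¬ (DecodesTo C t w j 0 ∧ DecodesTo C t w j 1) := by
    rintro ⟨⟨c, hc, hd, h0⟩, ⟨c', hc', hd', h1⟩⟩
    rw [eq_of_hammingDist_le ht hc hc' hd hd', h1] at h0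
    exact one_ne_zero h0
  have e0 : (0 : ZMod 2) - 1 = 1 := by decide
  simp only [bddOut_eq, decodesTo_add hc, hj, sub_self, e0]
  split_ifs with h h' h'
  · exact absurd ⟨h', h⟩ h01
  · simp
  · rfl
  · simp

theorem bddOut_zero (j : Fin n) : bddOut C t 0 j = 1 := by
  rw [bddOut_eq, if_pos]
  exact ⟨0, C.zero_mem, by simp, rfl⟩

end Decoding

/-! ### The rates of the outcomes of extrinsic bounded distance decoding -/

section Rates

variable {k : ℕ} {C : Submodule (ZMod 2) (Fin (k + 1) → ZMod 2)} {t : ℕ}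

/-- Probability of an error pattern of independent errors of probability `x`. -/
def patternProb (x : ℝ) (e : Fin k → ZMod 2) : ℝ := ∏ i, if e i = 1 then x else 1 - x

/-- Probability that position `j` of the all-zero codeword, received as `r`, is decoded to `s`, when
the other positions are received in error independently with probability `x`. -/
def outRateAt (C : Submodule (ZMod 2) (Fin (k + 1) → ZMod 2)) (t : ℕ) (x : ℝ) (r : ZMod 2)
    (s : SignType) (j : Fin (k + 1)) : ℝ :=
  ∑ e : Fin k → ZMod 2 with bddOut C t (j.insertNth r e) j = s, patternProb x e

/-- Average of `outRateAt` over the position. -/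
def outRate (C : Submodule (ZMod 2) (Fin (k + 1) → ZMod 2)) (t : ℕ) (x : ℝ) (r : ZMod 2)
    (s : SignType) : ℝ :=
  (∑ j, outRateAt C t x r s j) / (k + 1)

theorem sum_patternProb (x : ℝ) : ∑ e : Fin k → ZMod 2, patternProb x e = 1 := by
  have := Finset.prod_univ_sum (fun _ : Fin k => (Finset.univ : Finset (ZMod 2)))
    fun _ a => if a = 1 then x else 1 - x
  rw [Fintype.piFinset_univ] at this
  simp only [patternProb]
  rw [← this]
  have h : (Finset.univ : Finset (ZMod 2)) = {0, 1} := rfl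
  simp [h]

theorem sum_outRate (x : ℝ) (r : ZMod 2) : ∑ s, outRate C t x r s = 1 := by
  have hk : (k + 1 : ℝ) ≠ 0 := by positivity
  have h (j : Fin (k + 1)) : ∑ s, outRateAt C t x r s j = 1 := by
    simp only [outRateAt]
    rw [Finset.sum_fiberwise (s := Finset.univ)
      (g := fun e : Fin k → ZMod 2 => bddOut C t (j.insertNth r e) j), sum_patternProb]
  simp only [outRate]
  rw [← Finset.sum_div, Finset.sum_comm]
  simp [h, hk]

theorem patternProb_pos {x : ℝ} (hx : x ∈ Set.Ioo (0 : ℝ) 1) (e : Fin k → ZMod 2) :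
    0 < patternProb x e :=
  Finset.prod_pos fun i _ => by
    split_ifs
    · exact hx.1
    · exact sub_pos.2 hx.2

theorem outRate_nonneg {x : ℝ} (hx : x ∈ Set.Ioo (0 : ℝ) 1) (r : ZMod 2) (s : SignType) :
    0 ≤ outRate C t x r s :=
  div_nonneg (Finset.sum_nonneg fun _ _ => Finset.sum_nonneg fun e _ => (patternProb_pos hx e).le)
    (by positivity)

/-- For `x` strictly between `0` and `1` every error pattern has positive probability, so positivity
of a rate becomes a combinatorial statement about the code, independent of `x`. -/
theorem outRate_pos_iff {x : ℝ} (hx : x ∈ Set.Ioo (0 : ℝ) 1) (r : ZMod 2) (s : SignType) :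
    0 < outRate C t x r s ↔ ∃ (w : Fin (k + 1) → ZMod 2) (j : Fin (k + 1)),
      w j = r ∧ bddOut C t w j = s := by
  have hp (e : Fin k → ZMod 2) := patternProb_pos hx e
  have hk : (0 : ℝ) < k + 1 := by positivity
  rw [outRate, div_pos_iff_of_pos_right hk]
  constructor
  · intro h
    obtain ⟨j, -, hj⟩ := Finset.exists_lt_of_sum_lt (s := Finset.univ) (f := fun _ => (0 : ℝ))
      (by simpa using h)
    obtain ⟨e, he, -⟩ := Finset.exists_lt_of_sum_lt (f := fun _ => (0 : ℝ))
      (by simpa [outRateAt] using hj)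
    exact ⟨j.insertNth r e, j, by simp, (Finset.mem_filter.1 he).2⟩
  · rintro ⟨w, j, hr, hs⟩
    refine Finset.sum_pos' (fun _ _ => Finset.sum_nonneg fun e _ => (hp e).le)
      ⟨j, Finset.mem_univ _, Finset.sum_pos' (fun e _ => (hp e).le) ⟨j.removeNth w, ?_, hp _⟩⟩
    rw [Finset.mem_filter, ← hr, Fin.insertNth_self_removeNth]
    exact ⟨Finset.mem_univ _, hs⟩

/-- Adding a codeword exchanges the two outcomes that the combining rule compares. -/
theorem outRate_pos_swap (hC : ∀ j, ∃ c ∈ C, c j = 1) (ht : t = (minDist C - 1) / 2) {x : ℝ}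
    (hx : x ∈ Set.Ioo (0 : ℝ) 1) (r : ZMod 2) (s : SignType) (h : 0 < outRate C t x r s) :
    0 < outRate C t x (r + 1) (-s) := by
  rw [outRate_pos_iff hx] at h ⊢
  obtain ⟨w, j, rfl, rfl⟩ := h
  obtain ⟨c, hc, hj⟩ := hC j
  exact ⟨c + w, j, by simp [hj, add_comm], bddOut_add_of_eq_one ht hc hj w⟩

theorem outRate_zero_one_pos {x : ℝ} (hx : x ∈ Set.Ioo (0 : ℝ) 1) : 0 < outRate C t x 0 1 :=
  (outRate_pos_iff hx _ _).2 ⟨0, 0, rfl, bddOut_zero 0⟩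

theorem prod_erase_insertNth {M : Type*} [CommMonoid M] {α : Type*} (f : α → M) (j : Fin (k + 1))
    (r : α) (e : Fin k → α) :
    ∏ i ∈ Finset.univ.erase j, f ((j.insertNth r e : Fin (k + 1) → α) i) = ∏ i, f (e i) := by
  have h : Finset.univ.erase j = Finset.univ.image j.succAbove := by
    rw [Fin.image_succAbove_univ]
    ext
    simp
  rw [h, Finset.prod_image fun _ _ _ _ h => Fin.succAbove_right_injective h]
  simp

theorem sum_erase_eq_outRateAt (x : ℝ) (r : ZMod 2) (s : SignType) (j : Fin (k + 1)) :
    ∑ e : Fin (k + 1) → ZMod 2 with e j = r ∧ bddOut C t e j = s,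
      ∏ i ∈ Finset.univ.erase j, (if e i = 1 then x else 1 - x) = outRateAt C t x r s j := by
  rw [outRateAt, Finset.sum_filter, Finset.sum_filter,
    ← (Fin.insertNthEquiv (fun _ => ZMod 2) j).sum_comp, Fintype.sum_prod_type]
  have he (z : ZMod 2 × (Fin k → ZMod 2)) :
      Fin.insertNthEquiv (fun _ => ZMod 2) j z = j.insertNth z.1 z.2 := rfl
  simp only [he, Fin.insertNth_apply_same]
  rw [Finset.sum_eq_single r]
  · refine Finset.sum_congr rfl fun e _ => ?_
    rw [prod_erase_insertNth (fun a : ZMod 2 => if a = 1 then x else 1 - x), patternProb]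
    simp
  · intro a _ ha
    simp [ha]
  · simp

/-- Translation by a codeword with a `1` at `j` exchanges the codewords with a `0` and with a `1`
there, so each set is half of the code. The number of codewords then cancels from `outProb`, leaving
a uniform average over positions. -/
theorem card_codewords_eq (hC : ∀ j, ∃ c ∈ C, c j = 1) (j j' : Fin (k + 1)) (b b' : ZMod 2) :
    (Finset.univ.filter fun c : Fin (k + 1) → ZMod 2 => c ∈ C ∧ c j = b).card =
      (Finset.univ.filter fun c : Fin (k + 1) → ZMod 2 => c ∈ C ∧ c j' = b').card := by
  have h1 (j : Fin (k + 1)) (b : ZMod 2) :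
      (Finset.univ.filter fun c : Fin (k + 1) → ZMod 2 => c ∈ C ∧ c j = b).card =
        (Finset.univ.filter fun c : Fin (k + 1) → ZMod 2 => c ∈ C ∧ c j = b + 1).card := by
    obtain ⟨a, ha, haj⟩ := hC j
    refine Finset.card_nbij' (fun c => c + a) (fun c => c - a) ?_ ?_ ?_ ?_
    · intro c hc
      simp only [Finset.coe_filter, Finset.mem_univ, true_and, Set.mem_ofPred_eq] at hc ⊢
      exact ⟨C.add_mem hc.1 ha, by simp [hc.2, haj]⟩
    · intro c hc
      simp only [Finset.coe_filter, Finset.mem_univ, true_and, Set.mem_ofPred_eq] at hc ⊢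
      exact ⟨C.sub_mem hc.1 ha, by simp [hc.2, haj]⟩
    · intro c _
      simp
    · intro c _
      simp
  have h2 (j : Fin (k + 1)) (b : ZMod 2) :
      2 * (Finset.univ.filter fun c : Fin (k + 1) → ZMod 2 => c ∈ C ∧ c j = b).card =
        (Finset.univ.filter fun c : Fin (k + 1) → ZMod 2 => c ∈ C).card := by
    rw [← Finset.card_filter_add_card_filter_not (s := Finset.univ.filter fun c => c ∈ C)
      (fun c => c j = b), Finset.filter_filter, Finset.filter_filter, two_mul]
    congr 1
    rw [h1]
    congr 1
    refine Finset.filter_congr fun c _ => and_congr_right fun _ => ?_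
    generalize c j = a
    revert a b
    decide
  have := h2 j b
  have := h2 j' b'
  omega

/-- The conditional output probabilities do not depend on the transmitted codeword, up to the
symmetry of the decoder. -/
theorem outProb_eq_outRate (hC : ∀ j, ∃ c ∈ C, c j = 1) (ht : t = (minDist C - 1) / 2) (x : ℝ)
    (b r : ZMod 2) (s : SignType) :
    outProb C t x b r s = outRate C t x (r - b) (if b = 0 then s else -s) := by
  set N := (Finset.univ.filter fun c : Fin (k + 1) → ZMod 2 => c ∈ C ∧ c 0 = 0).card with hN
  have hN0 : (N : ℝ) ≠ 0 := by
    have : 0 < N := Finset.card_pos.2 ⟨0, by simp⟩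
    exact_mod_cast this.ne'
  have hin (j : Fin (k + 1)) (c : Fin (k + 1) → ZMod 2) (hc : c ∈ C) (hb : c j = b) :
      ∑ e : Fin (k + 1) → ZMod 2 with c j + e j = r ∧ bddOut C t (c + e) j = s,
        ∏ i ∈ Finset.univ.erase j, (if e i = 1 then x else 1 - x) =
          outRateAt C t x (r - b) (if b = 0 then s else -s) j := by
    rw [← sum_erase_eq_outRateAt]
    refine Finset.sum_congr (Finset.filter_congr fun e _ => ?_) fun _ _ => rfl
    refine and_congr (by rw [hb, eq_sub_iff_add_eq, add_comm]) ?_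
    split_ifs with h0
    · rw [bddOut_add_of_eq_zero hc (hb.trans h0)]
    · rw [bddOut_add_of_eq_one ht hc (hb.trans ((ZMod.two_eq_zero_or_one b).resolve_left h0)),
        neg_eq_iff_eq_neg]
  have hnum (j : Fin (k + 1)) : ∑ c : Fin (k + 1) → ZMod 2 with c ∈ C ∧ c j = b,
      ∑ e : Fin (k + 1) → ZMod 2 with c j + e j = r ∧ bddOut C t (c + e) j = s,
        ∏ i ∈ Finset.univ.erase j, (if e i = 1 then x else 1 - x) =
          N * outRateAt C t x (r - b) (if b = 0 then s else -s) j := by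
    rw [Finset.sum_congr rfl fun c hc => hin j c (Finset.mem_filter.1 hc).2.1
      (Finset.mem_filter.1 hc).2.2, Finset.sum_const, nsmul_eq_mul, card_codewords_eq hC j 0 b 0]
  rw [outProb, outRate]
  simp_rw [hnum, card_codewords_eq hC _ 0 b 0]
  rw [← Finset.mul_sum, Finset.sum_const, Finset.card_univ, Fintype.card_fin, nsmul_eq_mul, ← hN,
    mul_comm ((k + 1 : ℕ) : ℝ), mul_div_mul_left _ _ hN0]
  push_cast
  rfl

theorem patternProb_eq (x : ℝ) (e : Fin k → ZMod 2) :
    patternProb x e = x ^ (Finset.univ.filter fun i => e i = 1).card *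
      (1 - x) ^ (k - (Finset.univ.filter fun i => e i = 1).card) := by
  rw [patternProb, Finset.prod_ite, Finset.prod_const, Finset.prod_const]
  congr 2
  have := Finset.card_filter_add_card_filter_not (s := (Finset.univ : Finset (Fin k)))
    (fun i => e i = 1)
  rw [Finset.card_univ, Fintype.card_fin] at this
  omega

theorem sum_powerset_eq_outRateAt (x : ℝ) (r : ZMod 2) (s : SignType) (j : Fin (k + 1)) :
    ∑ S ∈ (Finset.univ.erase j).powerset with
        bddOut C t (fun i => if i = j then r else if i ∈ S then 1 else 0) j = s,
      x ^ S.card * (1 - x) ^ (k - S.card) = outRateAt C t x r s j := by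
  have key (e : Fin k → ZMod 2) : (fun i => if i = j then r else
      if i ∈ (Finset.univ.filter fun i => e i = 1).map j.succAboveEmb then 1 else 0) =
        (j.insertNth r e : Fin (k + 1) → ZMod 2) := by
    funext i
    refine Fin.succAboveCases j ?_ (fun i => ?_) i
    · simp
    · simp only [Fin.succAbove_ne, if_false, Finset.mem_map, Finset.mem_filter, Finset.mem_univ,
        true_and, Fin.succAboveEmb_apply, Fin.succAbove_right_inj, exists_eq_right,
        Fin.insertNth_apply_succAbove]
      rcases ZMod.two_eq_zero_or_one (e i) with h | h <;> simp [h]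
  have inv (S : Finset (Fin (k + 1))) (hS : S ⊆ Finset.univ.erase j) :
      (Finset.univ.filter fun i : Fin k => (if j.succAbove i ∈ S then (1 : ZMod 2) else 0) = 1).map
        j.succAboveEmb = S := by
    ext i
    refine Fin.succAboveCases j ?_ (fun i => ?_) i
    · have : j ∉ S := fun h => by simpa using hS h
      simp [this, Fin.succAbove_ne]
    · simp
  rw [outRateAt]
  symm
  refine Finset.sum_nbij' (fun e => (Finset.univ.filter fun i => e i = 1).map j.succAboveEmb)
    (fun S i => if j.succAbove i ∈ S then 1 else 0) ?_ ?_ ?_ ?_ ?_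
  · intro e he
    rw [Finset.mem_filter] at he ⊢
    refine ⟨Finset.mem_powerset.2 fun i hi => ?_, by rw [key]; exact he.2⟩
    obtain ⟨i, -, rfl⟩ := Finset.mem_map.1 hi
    simp [Fin.succAbove_ne]
  · intro S hS
    rw [Finset.mem_filter] at hS ⊢
    refine ⟨Finset.mem_univ _, ?_⟩
    rw [← key, inv S (Finset.mem_powerset.1 hS.1)]
    exact hS.2
  · intro e _
    funext i
    simp only [Finset.mem_map, Finset.mem_filter, Finset.mem_univ, true_and,
      Fin.succAboveEmb_apply, Fin.succAbove_right_inj, exists_eq_right]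
    rcases ZMod.two_eq_zero_or_one (e i) with h | h <;> simp [h]
  · intro S hS
    exact inv S (Finset.mem_powerset.1 (Finset.mem_filter.1 hS).1)
  · intro e _
    rw [patternProb_eq, Finset.card_map]

/-- Error patterns are grouped by weight: all patterns of weight `i` have the same probability, and
the binomial coefficient in `binAvg` cancels the one that normalizes `decProb`. -/
theorem binAvg_decProb (x : ℝ) (r : ZMod 2) (s : SignType) :
    binAvg (k + 1) (decProb C t r s) x = outRate C t x r s := by
  have h1 (j : Fin (k + 1)) : outRateAt C t x r s j = ∑ i ∈ Finset.range (k + 1),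
      x ^ i * (1 - x) ^ (k - i) * (((Finset.univ.erase j).powersetCard i).filter fun S =>
        bddOut C t (fun k => if k = j then r else if k ∈ S then 1 else 0) j = s).card := by
    rw [← sum_powerset_eq_outRateAt, Finset.sum_filter, Finset.sum_powerset,
      Finset.card_erase_of_mem (Finset.mem_univ _), Finset.card_univ, Fintype.card_fin,
      Nat.add_sub_cancel]
    refine Finset.sum_congr rfl fun i _ => ?_
    rw [← Finset.sum_filter, Finset.sum_congr rfl fun S hS => by
      rw [(Finset.mem_powersetCard.1 (Finset.mem_filter.1 hS).1).2], Finset.sum_const,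
      nsmul_eq_mul, mul_comm]
  rw [binAvg, outRate]
  simp_rw [h1]
  rw [Finset.sum_comm, Finset.sum_div]
  refine Finset.sum_congr rfl fun i hi => ?_
  have hc : ((k.choose i : ℕ) : ℝ) ≠ 0 := by
    exact_mod_cast (Nat.choose_pos (Nat.lt_succ_iff.1 (Finset.mem_range.1 hi))).ne'
  have hi' : k + 1 - i - 1 = k - i := by omega
  rw [decProb, hi', ← Finset.mul_sum, Nat.add_sub_cancel, ← Finset.sum_div]
  push_cast
  field_simp

theorem binAvg_one_sub_sub (P P' : ℕ → ℝ) (x : ℝ) :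
    binAvg (k + 1) (fun i => 1 - P i - P' i) x = 1 - binAvg (k + 1) P x - binAvg (k + 1) P' x := by
  have h : ∑ i ∈ Finset.range (k + 1), ((k + 1 - 1).choose i : ℝ) * x ^ i *
      (1 - x) ^ (k + 1 - i - 1) = 1 := by
    have := add_pow x (1 - x) k
    rw [add_sub_cancel, one_pow] at this
    refine Eq.trans (Finset.sum_congr rfl fun i _ => ?_) this.symm
    rw [Nat.add_sub_cancel, (by omega : k + 1 - i - 1 = k - i)]
    ring
  refine Eq.trans ?_ (congrArg (fun a => a - binAvg (k + 1) P x - binAvg (k + 1) P' x) h)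
  simp only [binAvg]
  rw [← Finset.sum_sub_distrib, ← Finset.sum_sub_distrib]
  exact Finset.sum_congr rfl fun i _ => by ring

theorem sum_signType (f : SignType → ℝ) : ∑ s, f s = f 0 + (f (-1) + f 1) := by
  have h : (Finset.univ : Finset SignType) = {0, -1, 1} := rfl
  rw [h, Finset.sum_insert (by decide), Finset.sum_insert (by decide), Finset.sum_singleton]

theorem binAvg_erased (x : ℝ) (r : ZMod 2) :
    binAvg (k + 1) (fun i => 1 - decProb C t r (-1) i - decProb C t r 1 i) x =
      outRate C t x r 0 := by
  rw [binAvg_one_sub_sub, binAvg_decProb, binAvg_decProb,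
    ← sum_outRate (C := C) (t := t) x r, sum_signType]
  ring

end Rates

end

noncomputable section

/-! ### The symmetrized channel -/

section Channel

variable {m : ℕ} {σ : ℝ}

theorem mean_pos (hm : 1 ≤ m) (hσ : 0 < σ) (j : ℕ) : 0 < mean m σ j := by
  have h1 : (2 : ℝ) ≤ 2 ^ m := by
    calc (2 : ℝ) = 2 ^ 1 := (pow_one 2).symm
      _ ≤ 2 ^ m := pow_le_pow_right₀ (by norm_num) hm
  have h2 : 0 < Delta m := Real.sqrt_pos.2 (div_pos (by norm_num) (by nlinarith))
  unfold mean
  positivity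

theorem var_eq (m : ℕ) (σ : ℝ) (j : ℕ) : var m σ j = 2 * mean m σ j := by
  unfold var mean
  ring

theorem var_pos (hm : 1 ≤ m) (hσ : 0 < σ) (j : ℕ) : 0 < var m σ j := by
  have := mean_pos hm hσ j
  rw [var_eq]
  positivity

theorem weight_nonneg (m j : ℕ) : 0 ≤ weight m j := by
  have : (1 : ℝ) ≤ 2 ^ (m - Nat.clog 2 (j + 1)) := one_le_pow₀ (by norm_num)
  exact div_nonneg (mul_nonneg (by norm_num) (sub_nonneg.2 this)) (by positivity)

theorem weight_zero_pos (hm : 1 ≤ m) : 0 < weight m 0 := by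
  have h1 : (2 : ℝ) ≤ 2 ^ m := by
    calc (2 : ℝ) = 2 ^ 1 := (pow_one 2).symm
      _ ≤ 2 ^ m := pow_le_pow_right₀ (by norm_num) hm
  have hm' : (0 : ℝ) < m := by exact_mod_cast hm
  have h2 : Nat.clog 2 (0 + 1) = 0 := Nat.clog_one_right 2
  rw [weight, h2, Nat.sub_zero]
  exact div_pos (by linarith) (by positivity)

/-- Dyadic blocks: on `2 ^ q ≤ j < 2 ^ (q + 1)` the logarithm is constantly `q + 1`, so each block
contributes `2 ^ q * 2 ^ (p - q) = 2 ^ p`. The index `0` gives `2 ^ (p + 1)`. -/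
theorem sum_two_pow_sub_clog (p q : ℕ) (hq : q ≤ p) :
    ∑ j ∈ Finset.range (2 ^ q), (2 : ℝ) ^ (p + 1 - Nat.clog 2 (j + 1)) =
      2 ^ (p + 1) + q * 2 ^ p := by
  induction q with
  | zero => simp
  | succ q ih =>
    have h (i : ℕ) (hi : i ∈ Finset.range (2 ^ q)) : Nat.clog 2 (2 ^ q + i + 1) = q + 1 := by
      rw [Finset.mem_range] at hi
      refine le_antisymm (Nat.clog_le_of_le_pow ?_) ((Nat.lt_clog_iff_pow_lt (by norm_num)).2 ?_)
      · rw [pow_succ]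
        omega
      · omega
    rw [pow_succ, mul_two, Finset.sum_range_add, ih (by omega),
      Finset.sum_congr rfl fun i hi => by rw [h i hi], Finset.sum_const, Finset.card_range,
      nsmul_eq_mul]
    push_cast
    rw [← pow_add, show q + (p - q) = p by omega]
    ring

theorem sum_weight (hm : 1 ≤ m) : ∑ j ∈ Finset.range (2 ^ m / 2), weight m j = 1 := by
  obtain ⟨p, rfl⟩ : ∃ p, m = p + 1 := ⟨m - 1, by omega⟩
  have h1 : 2 ^ (p + 1) / 2 = 2 ^ p := by rw [pow_succ, Nat.mul_div_cancel _ (by norm_num)]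
  have h2 := sum_two_pow_sub_clog p p le_rfl
  simp only [weight]
  rw [h1, ← Finset.sum_div, ← Finset.mul_sum, Finset.sum_sub_distrib, h2, Finset.sum_const,
    Finset.card_range, nsmul_eq_mul, div_eq_one_iff_eq (by positivity)]
  push_cast
  ring

theorem gaussianPDFReal_neg_neg (μ : ℝ) (v : NNReal) (x : ℝ) :
    gaussianPDFReal (-μ) v (-x) = gaussianPDFReal μ v x := by
  simp only [gaussianPDFReal]
  congr 3
  ring

theorem llrPdf_zero (m : ℕ) (σ l : ℝ) : llrPdf m σ 0 l = ∑ j ∈ Finset.range (2 ^ m / 2),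
    weight m j * gaussianPDFReal (mean m σ j) (var m σ j).toNNReal l := by
  simp [llrPdf]

theorem llrPdf_one (m : ℕ) (σ l : ℝ) : llrPdf m σ 1 l = ∑ j ∈ Finset.range (2 ^ m / 2),
    weight m j * gaussianPDFReal (-mean m σ j) (var m σ j).toNNReal l := by
  simp [llrPdf, ZMod.val_one]

theorem llrPdf_one_neg (m : ℕ) (σ l : ℝ) : llrPdf m σ 1 (-l) = llrPdf m σ 0 l := by
  simp_rw [llrPdf_zero, llrPdf_one, gaussianPDFReal_neg_neg]

/-- The model density is already symmetric, so the channel adapters leave it unchanged. -/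
theorem symLlrPdf_zero (m : ℕ) (σ l : ℝ) : symLlrPdf m σ 0 l = llrPdf m σ 0 l := by
  rw [symLlrPdf, sub_zero, llrPdf_one_neg, add_self_div_two]

theorem symLlrPdf_one (m : ℕ) (σ l : ℝ) : symLlrPdf m σ 1 l = llrPdf m σ 1 l := by
  have h := llrPdf_one_neg m σ (-l)
  rw [neg_neg] at h
  rw [symLlrPdf, sub_self, ← h, add_self_div_two]

/-- Since the variance is twice the mean, the exponents of the Gaussians with means `μ_j` and `-μ_j`
differ by exactly `l`. The factor is the same for all `j`, so it passes to the mixture: `l` is a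
true LLR. -/
theorem llrPdf_zero_eq_exp_mul (hm : 1 ≤ m) (hσ : 0 < σ) (l : ℝ) :
    llrPdf m σ 0 l = Real.exp l * llrPdf m σ 1 l := by
  rw [llrPdf_zero, llrPdf_one, Finset.mul_sum]
  refine Finset.sum_congr rfl fun j _ => ?_
  have h1 := mean_pos hm hσ j
  simp only [gaussianPDFReal, Real.coe_toNNReal _ (var_pos hm hσ j).le]
  rw [show -(l - mean m σ j) ^ 2 / (2 * var m σ j) =
    l + -(l - -mean m σ j) ^ 2 / (2 * var m σ j) by
      rw [var_eq]
      field_simp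
      ring, Real.exp_add]
  ring

theorem llrPdf_zero_pos (hm : 1 ≤ m) (hσ : 0 < σ) (l : ℝ) : 0 < llrPdf m σ 0 l := by
  rw [llrPdf_zero]
  refine Finset.sum_pos' (fun j _ => mul_nonneg (weight_nonneg m j) (gaussianPDFReal_nonneg _ _ _))
    ⟨0, ?_, mul_pos (weight_zero_pos hm) (gaussianPDFReal_pos _ _ _ ?_)⟩
  · obtain ⟨p, rfl⟩ : ∃ p, m = p + 1 := ⟨m - 1, by omega⟩
    rw [Finset.mem_range, pow_succ, Nat.mul_div_cancel _ (by norm_num)]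
    positivity
  · simpa using var_pos hm hσ 0

theorem llrPdf_one_pos (hm : 1 ≤ m) (hσ : 0 < σ) (l : ℝ) : 0 < llrPdf m σ 1 l := by
  have h := llrPdf_zero_pos hm hσ l
  rw [llrPdf_zero_eq_exp_mul hm hσ] at h
  exact pos_of_mul_pos_right h (Real.exp_pos l).le

theorem measurable_llrPdf (m : ℕ) (σ : ℝ) (b : ZMod 2) : Measurable (llrPdf m σ b) :=
  Finset.measurable_fun_sum _ fun _ _ => (measurable_gaussianPDFReal _ _).const_mul _

theorem measurable_symLlrPdf (m : ℕ) (σ : ℝ) (b : ZMod 2) : Measurable (symLlrPdf m σ b) :=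
  ((measurable_llrPdf m σ b).add ((measurable_llrPdf m σ (1 - b)).comp measurable_neg)).div_const 2

theorem symLlrLaw_zero_eq (hm : 1 ≤ m) (hσ : 0 < σ) : symLlrLaw m σ 0 =
    ∑ j ∈ Finset.range (2 ^ m / 2), ENNReal.ofReal (weight m j) •
      gaussianReal (mean m σ j) (var m σ j).toNNReal := by
  ext A hA
  rw [symLlrLaw, withDensity_apply _ hA, Measure.finsetSum_apply]
  simp_rw [symLlrPdf_zero, llrPdf_zero]
  have h1 (l : ℝ) : ENNReal.ofReal (∑ j ∈ Finset.range (2 ^ m / 2),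
      weight m j * gaussianPDFReal (mean m σ j) (var m σ j).toNNReal l) =
      ∑ j ∈ Finset.range (2 ^ m / 2), ENNReal.ofReal (weight m j) *
        gaussianPDF (mean m σ j) (var m σ j).toNNReal l := by
    rw [ENNReal.ofReal_sum_of_nonneg fun j _ =>
      mul_nonneg (weight_nonneg m j) (gaussianPDFReal_nonneg _ _ _)]
    exact Finset.sum_congr rfl fun j _ => ENNReal.ofReal_mul (weight_nonneg m j)
  simp_rw [h1]
  rw [lintegral_finsetSum _ fun j _ => (measurable_gaussianPDF _ _).const_mul _]
  refine Finset.sum_congr rfl fun j _ => ?_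
  have hv : (var m σ j).toNNReal ≠ 0 := by simpa using var_pos hm hσ j
  rw [lintegral_const_mul _ (measurable_gaussianPDF _ _), Measure.smul_apply, smul_eq_mul,
    gaussianReal_apply _ hv]

theorem isProbabilityMeasure_symLlrLaw (hm : 1 ≤ m) (hσ : 0 < σ) :
    IsProbabilityMeasure (symLlrLaw m σ 0) := by
  refine ⟨?_⟩
  rw [symLlrLaw_zero_eq hm hσ, Measure.finsetSum_apply]
  simp only [Measure.smul_apply, measure_univ, smul_eq_mul, mul_one]
  rw [← ENNReal.ofReal_sum_of_nonneg fun j _ => weight_nonneg m j, sum_weight hm, ENNReal.ofReal_one]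

theorem symLlrLaw_real_pos (hm : 1 ≤ m) (hσ : 0 < σ) {A : Set ℝ} (hA : volume A ≠ 0) :
    0 < (symLlrLaw m σ 0).real A := by
  have := isProbabilityMeasure_symLlrLaw hm hσ
  refine ENNReal.toReal_pos (fun h => hA ?_) (measure_ne_top _ _)
  refine withDensity_absolutelyContinuous' (f := fun l => ENNReal.ofReal (symLlrPdf m σ 0 l))
    (measurable_symLlrPdf m σ 0).ennreal_ofReal.aemeasurable (ae_of_all _ fun l => ?_) h
  rw [symLlrPdf_zero]
  simpa using llrPdf_zero_pos hm hσ l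

theorem gaussianReal_real_Ioi (y : ℝ) : (gaussianReal 0 1).real (Set.Ioi y) = Q y := by
  rw [measureReal_def, gaussianReal_apply_eq_integral _ one_ne_zero, ENNReal.toReal_ofReal
    (setIntegral_nonneg measurableSet_Ioi fun _ _ => gaussianPDFReal_nonneg _ _ _), Q,
    ← integral_const_mul]
  refine integral_congr_ae (ae_of_all _ fun ξ => ?_)
  simp [gaussianPDFReal]

theorem gaussianReal_real_Iio (μ a : ℝ) {v : ℝ} (hv : 0 < v) :
    (gaussianReal μ v.toNNReal).real (Set.Iio (-a)) = Q ((a + μ) / √v) := by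
  have hs : 0 < √v := Real.sqrt_pos.2 hv
  -- The scaling factor is negative, so that the lower tail becomes the upper tail measured by `Q`.
  have h1 : gaussianReal μ v.toNNReal = (gaussianReal 0 1).map fun x => μ + -√v * x := by
    have h2 := gaussianReal_map_const_mul (μ := 0) (v := 1) (-√v)
    have h3 := gaussianReal_map_const_add (μ := -√v * 0)
      (v := NNReal.mk ((-√v) ^ 2) (sq_nonneg _) * 1) μ
    rw [← h2, Measure.map_map (by fun_prop) (by fun_prop)] at h3
    refine Eq.trans ?_ h3.symm
    congr 1
    · ring
    · ext
      simp [Real.sq_sqrt hv.le, hv.le]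
  have hm : Measurable fun x : ℝ => μ + -√v * x := by fun_prop
  rw [h1, map_measureReal_apply hm measurableSet_Iio, ← gaussianReal_real_Ioi]
  congr 1
  ext x
  simp only [Set.mem_preimage, Set.mem_Iio, Set.mem_Ioi]
  rw [div_lt_iff₀ hs]
  constructor <;> intro h <;> linarith

theorem symLlrLaw_real_Iio (hm : 1 ≤ m) (hσ : 0 < σ) (a : ℝ) :
    (symLlrLaw m σ 0).real (Set.Iio (-a)) = mixQ m σ a := by
  rw [symLlrLaw_zero_eq hm hσ, measureReal_def, Measure.finsetSum_apply]
  simp only [Measure.smul_apply, smul_eq_mul]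
  rw [ENNReal.toReal_sum fun j _ => ENNReal.mul_ne_top ENNReal.ofReal_ne_top (measure_ne_top _ _),
    mixQ]
  refine Finset.sum_congr rfl fun j _ => ?_
  rw [ENNReal.toReal_mul, ENNReal.toReal_ofReal (weight_nonneg m j), ← measureReal_def, gaussianReal_real_Iio _ _ (var_pos hm hσ j), sd]

theorem mixQDiff_eq (m : ℕ) (σ a : ℝ) : mixQDiff m σ a = mixQ m σ a - mixQ m σ 0 := by
  simp only [mixQDiff, mixQ, zero_add]
  rw [← Finset.sum_sub_distrib]
  exact Finset.sum_congr rfl fun j _ => by ring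

theorem symLlrLaw_real_Ico (hm : 1 ≤ m) (hσ : 0 < σ) {a : ℝ} (ha : a ≤ 0) :
    (symLlrLaw m σ 0).real (Set.Ico 0 (-a)) = mixQDiff m σ a := by
  have := isProbabilityMeasure_symLlrLaw hm hσ
  have h0 := symLlrLaw_real_Iio hm hσ 0
  rw [neg_zero] at h0
  rw [mixQDiff_eq, ← symLlrLaw_real_Iio hm hσ, ← h0, ← measureReal_sdiff (Set.Iio_subset_Iio (by
    linarith)) measurableSet_Iio]
  congr 1
  ext x
  simp [and_comm]

end Channel

end

noncomputable section

open scoped Classical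

/-! ### One half-iteration of density evolution -/

theorem hardBit_eq_one_iff (l : ℝ) : hardBit l = 1 ↔ l < 0 := by
  unfold hardBit
  split_ifs with h <;> simp [h]

theorem hardBit_eq_zero_iff (l : ℝ) : hardBit l = 0 ↔ 0 ≤ l := by
  unfold hardBit
  split_ifs with h
  · simpa using h
  · simpa using h

theorem measurableSet_hardBit (b : ZMod 2) : MeasurableSet {l : ℝ | hardBit l = b} := by
  rcases ZMod.two_eq_zero_or_one b with rfl | rfl
  · simp_rw [hardBit_eq_zero_iff]
    exact measurableSet_Ici
  · simp_rw [hardBit_eq_one_iff]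
    exact measurableSet_Iio

theorem sum_zmod_two (f : ZMod 2 → ℝ) : ∑ r, f r = f 0 + f 1 := by
  have h : (Finset.univ : Finset (ZMod 2)) = {0, 1} := rfl
  rw [h, Finset.sum_insert (by decide), Finset.sum_singleton]

variable {k m : ℕ} {C : Submodule (ZMod 2) (Fin (k + 1) → ZMod 2)} {t : ℕ} {σ : ℝ}

/-- Probability that the channel hard decision on a zero bit is `r` and that combining the LLR with
the output `s` of the decoder gives the hard decision `b`. -/
def decisionMass (C : Submodule (ZMod 2) (Fin (k + 1) → ZMod 2)) (t m : ℕ) (σ x : ℝ) (b r : ZMod 2)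
    (s : SignType) : ℝ :=
  (symLlrLaw m σ 0).real {l | hardBit l = r ∧ hardBit (softValue C t m σ x s l) = b}

/-- Error probability of an outgoing message, when the combining rule is run with parameter `x` and
the incoming messages have error probability `y`. -/
def halfStep (C : Submodule (ZMod 2) (Fin (k + 1) → ZMod 2)) (t m : ℕ) (σ x y : ℝ) : ℝ :=
  ∑ r, ∑ s, decisionMass C t m σ x 1 r s * outRate C t y r s

/-- Once the hard decision is fixed to `r`, the output probabilities are constants and the soft
value is a measurable function of the two densities. -/
theorem measurableSet_decision (x : ℝ) (b r : ZMod 2) (s : SignType) :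
    MeasurableSet {l | hardBit l = r ∧ hardBit (softValue C t m σ x s l) = b} := by
  have h : {l | hardBit l = r ∧ hardBit (softValue C t m σ x s l) = b} = {l | hardBit l = r} ∩
      (fun l => Real.log ((outProb C t x 0 r s * symLlrPdf m σ 0 l) /
        (outProb C t x 1 r s * symLlrPdf m σ 1 l))) ⁻¹' {y | hardBit y = b} := by
    ext l
    simp only [Set.mem_ofPred_eq, Set.mem_inter_iff, Set.mem_preimage]
    refine and_congr_right fun hl => ?_
    rw [softValue, hl]
  rw [h]
  refine (measurableSet_hardBit r).inter (Measurable.log ?_ (measurableSet_hardBit b))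
  exact ((measurable_symLlrPdf m σ 0).const_mul _).div ((measurable_symLlrPdf m σ 1).const_mul _)

/-- The rule by which a constraint node forms a message from the `k` messages at the other positions
and the channel LLR, at step `d` of a decoder run with the input error probabilities `xs`. -/
def nodeRule (C : Submodule (ZMod 2) (Fin (k + 1) → ZMod 2)) (t m : ℕ) (σ : ℝ) (xs : ℕ → ℝ) (d : ℕ)
    (j : Fin (k + 1)) (e : Fin k → ZMod 2) (l : ℝ) : ZMod 2 :=
  cnMessage C t m σ (xs d) (j.insertNth 0 e) j l

/-- The `0` inserted at position `j` is a placeholder, overwritten by the channel hard decision. -/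
theorem nodeRule_eq (xs : ℕ → ℝ) (d : ℕ) (j : Fin (k + 1)) (e : Fin k → ZMod 2) (l : ℝ) :
    nodeRule C t m σ xs d j e l =
      hardBit (softValue C t m σ (xs d) (bddOut C t (j.insertNth (hardBit l) e) j) l) := by
  rw [nodeRule, cnMessage, Fin.update_insertNth]

theorem cnMessage_eq_nodeRule (xs : ℕ → ℝ) (d : ℕ) (ψ : Fin (k + 1) → ZMod 2) (j : Fin (k + 1))
    (l : ℝ) : cnMessage C t m σ (xs d) ψ j l =
      nodeRule C t m σ xs d j (fun i => ψ (j.succAbove i)) l := by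
  rw [nodeRule_eq, cnMessage, ← Fin.insertNth_removeNth]
  rfl

theorem setOf_nodeRule_eq (xs : ℕ → ℝ) (d : ℕ) (j : Fin (k + 1)) (e : Fin k → ZMod 2)
    (b : ZMod 2) : {l | nodeRule C t m σ xs d j e l = b} =
      ⋃ r ∈ (Finset.univ : Finset (ZMod 2)), {l | hardBit l = r ∧
        hardBit (softValue C t m σ (xs d) (bddOut C t (j.insertNth r e) j) l) = b} := by
  ext l
  simp [nodeRule_eq]

theorem measurableSet_nodeRule (xs : ℕ → ℝ) (d : ℕ) (j : Fin (k + 1)) (e : Fin k → ZMod 2)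
    (b : ZMod 2) : MeasurableSet {l | nodeRule C t m σ xs d j e l = b} := by
  rw [setOf_nodeRule_eq]
  exact Finset.measurableSet_biUnion _ fun r _ => measurableSet_decision _ _ _ _

theorem measureReal_nodeRule [IsProbabilityMeasure (symLlrLaw m σ 0)] (xs : ℕ → ℝ) (d : ℕ)
    (j : Fin (k + 1)) (e : Fin k → ZMod 2) (b : ZMod 2) :
    (symLlrLaw m σ 0).real {l | nodeRule C t m σ xs d j e l = b} =
      ∑ r, decisionMass C t m σ (xs d) b r (bddOut C t (j.insertNth r e) j) := by
  rw [setOf_nodeRule_eq, measureReal_biUnion_finset (fun r _ r' _ hr =>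
    Set.disjoint_left.2 fun l hl hl' => hr (hl.1.symm.trans hl'.1))
    fun r _ => measurableSet_decision _ _ _ _]
  rfl

/-- Incoming messages that are independently wrong with probability `y` form the error pattern law
`patternProb y`. The decision depends on the pattern only through the decoder output `s`, so
patterns are grouped by `s`. -/
theorem evolve_nodeRule_succ (hm : 1 ≤ m) (hσ : 0 < σ) (xs : ℕ → ℝ) (d : ℕ) :
    evolve (symLlrLaw m σ 0) (nodeRule C t m σ xs) hardBit (d + 1) 1 =
      halfStep C t m σ (xs d) (evolve (symLlrLaw m σ 0) (nodeRule C t m σ xs) hardBit d 1) := by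
  have := isProbabilityMeasure_symLlrLaw hm hσ
  set y := evolve (symLlrLaw m σ 0) (nodeRule C t m σ xs) hardBit d 1 with hy
  have h0 : evolve (symLlrLaw m σ 0) (nodeRule C t m σ xs) hardBit d 0 = 1 - y := by
    have h := sum_evolve (μ := symLlrLaw m σ 0)
      (cn := nodeRule C t m σ xs) (measurableSet_nodeRule xs) measurableSet_hardBit d
    rw [sum_zmod_two] at h
    linarith
  have hp (e : Fin k → ZMod 2) :
      ∏ i, evolve (symLlrLaw m σ 0) (nodeRule C t m σ xs) hardBit d (e i) = patternProb y e := by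
    refine Finset.prod_congr rfl fun i _ => ?_
    rcases ZMod.two_eq_zero_or_one (e i) with h | h <;> simp [h, h0, hy]
  have hj (j : Fin (k + 1)) : ∑ e : Fin k → ZMod 2,
      (symLlrLaw m σ 0).real {l | nodeRule C t m σ xs d j e l = 1} * patternProb y e =
      ∑ r, ∑ s, decisionMass C t m σ (xs d) 1 r s * outRateAt C t y r s j := by
    simp_rw [measureReal_nodeRule, Finset.sum_mul]
    rw [Finset.sum_comm]
    refine Finset.sum_congr rfl fun r _ => ?_
    rw [← Finset.sum_fiberwise (s := Finset.univ)
      (g := fun e : Fin k → ZMod 2 => bddOut C t (j.insertNth r e) j)]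
    refine Finset.sum_congr rfl fun s _ => ?_
    rw [outRateAt, Finset.mul_sum]
    exact Finset.sum_congr rfl fun e he => by rw [(Finset.mem_filter.1 he).2]
  rw [evolve]
  simp_rw [hp, hj]
  rw [Finset.sum_comm, Finset.sum_div, halfStep]
  refine Finset.sum_congr rfl fun r _ => ?_
  rw [Finset.sum_comm, Finset.sum_div]
  refine Finset.sum_congr rfl fun s _ => ?_
  rw [outRate, ← Finset.mul_sum, mul_div_assoc]

theorem evolve_nodeRule_zero (hm : 1 ≤ m) (hσ : 0 < σ) (xs : ℕ → ℝ) :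
    evolve (symLlrLaw m σ 0) (nodeRule C t m σ xs) hardBit 0 1 = mixQ m σ 0 := by
  rw [evolve, ← symLlrLaw_real_Iio hm hσ, neg_zero]
  simp_rw [hardBit_eq_one_iff]
  rfl

theorem sum_decisionMass (hm : 1 ≤ m) (hσ : 0 < σ) (x y : ℝ) :
    ∑ r, ∑ s, decisionMass C t m σ x 0 r s * outRate C t y r s + halfStep C t m σ x y = 1 := by
  have := isProbabilityMeasure_symLlrLaw hm hσ
  have h1 (r : ZMod 2) (s : SignType) : decisionMass C t m σ x 0 r s + decisionMass C t m σ x 1 r s =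
      (symLlrLaw m σ 0).real {l | hardBit l = r} := by
    rw [decisionMass, decisionMass, ← measureReal_union (Set.disjoint_left.2 fun l hl hl' =>
      zero_ne_one (hl.2.symm.trans hl'.2)) (measurableSet_decision _ _ _ _)]
    congr 1
    ext l
    have := ZMod.two_eq_zero_or_one (hardBit (softValue C t m σ x s l))
    simp only [Set.mem_union, Set.mem_ofPred_eq]
    tauto
  rw [halfStep, ← Finset.sum_add_distrib]
  simp_rw [← Finset.sum_add_distrib, ← add_mul, h1, ← Finset.mul_sum, sum_outRate, mul_one]
  exact sum_measureReal_eq_one measurableSet_hardBit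

section Rule

variable (hC : ∀ j, ∃ c ∈ C, c j = 1) (ht : t = (minDist C - 1) / 2) (hm : 1 ≤ m) (hσ : 0 < σ)
  {x : ℝ} (hx : x ∈ Set.Ioo (0 : ℝ) 1)

include hC ht hm hσ hx

/-- The density ratio is `exp l`, and the decoder ratio compares the outcome `(r, s)` for a zero bit
with `(r + 1, -s)`; this is the pairing of `P^e` with `Q^c`, `P^c` with `Q^e`, and `P^ε` with `Q^ε`.
Both rates must be positive for the logarithm to split, since `Real.log 0 = 0`. -/
theorem softValue_eq (r : ZMod 2) (s : SignType) (hr : 0 < outRate C t x r s) (l : ℝ)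
    (hl : hardBit l = r) : softValue C t m σ x s l =
      Real.log (outRate C t x r s / outRate C t x (r + 1) (-s)) + l := by
  have h1 := outRate_pos_swap hC ht hx r s hr
  have h2 : r - 1 = r + 1 := by
    generalize r = a
    revert a
    decide
  have h3 := llrPdf_one_pos hm hσ l
  rw [softValue, hl, outProb_eq_outRate hC ht, outProb_eq_outRate hC ht, if_pos rfl,
    if_neg one_ne_zero, sub_zero, h2, symLlrPdf_zero, symLlrPdf_one,
    llrPdf_zero_eq_exp_mul hm hσ, ← mul_assoc, mul_div_mul_right _ _ h3.ne', mul_div_right_comm,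
    Real.log_mul (div_pos hr h1).ne' (Real.exp_pos l).ne', Real.log_exp]

theorem decisionMass_one_one (s : SignType) (hr : 0 < outRate C t x 1 s) :
    decisionMass C t m σ x 1 1 s =
      mixQ m σ (max (Real.log (outRate C t x 1 s / outRate C t x 0 (-s))) 0) := by
  rw [decisionMass, ← symLlrLaw_real_Iio hm hσ]
  congr 1
  ext l
  rw [Set.mem_ofPred_eq, Set.mem_Iio]
  have h1 : (1 : ZMod 2) + 1 = 0 := by decide
  constructor
  · rintro ⟨hl, hs⟩
    rw [softValue_eq hC ht hm hσ hx 1 s hr l hl, hardBit_eq_one_iff, h1] at hs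
    rw [hardBit_eq_one_iff] at hl
    rw [lt_neg, max_lt_iff]
    constructor <;> linarith
  · intro h
    rw [lt_neg, max_lt_iff] at h
    have hl : hardBit l = 1 := (hardBit_eq_one_iff l).2 (by linarith)
    refine ⟨hl, ?_⟩
    rw [softValue_eq hC ht hm hσ hx 1 s hr l hl, hardBit_eq_one_iff, h1]
    linarith

/-- With `a` the log ratio, a correct hard decision is overturned when `0 ≤ l < -a`, which is
possible only for `a < 0`; hence the factor `Ubar`. -/
theorem decisionMass_one_zero (s : SignType) (hr : 0 < outRate C t x 0 s) :
    decisionMass C t m σ x 1 0 s =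
      mixQDiff m σ (Real.log (outRate C t x 0 s / outRate C t x 1 (-s))) *
        Ubar (Real.log (outRate C t x 0 s / outRate C t x 1 (-s))) := by
  set a := Real.log (outRate C t x 0 s / outRate C t x 1 (-s)) with ha
  have h : {l | hardBit l = 0 ∧ hardBit (softValue C t m σ x s l) = 1} = Set.Ico 0 (-a) := by
    ext l
    rw [Set.mem_ofPred_eq, Set.mem_Ico, hardBit_eq_zero_iff]
    refine and_congr_right fun hl => ?_
    rw [softValue_eq hC ht hm hσ hx 0 s hr l ((hardBit_eq_zero_iff l).2 hl), hardBit_eq_one_iff,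
      zero_add, ← ha, lt_neg_iff_add_neg, add_comm]
  rw [decisionMass, h, Ubar]
  split_ifs with h0
  · rw [symLlrLaw_real_Ico hm hσ h0.le, mul_one]
  · rw [Set.Ico_eq_empty (by linarith), measureReal_empty, mul_zero]

/-- With equal parameters, the half-iteration is the map `g`. -/
theorem halfStep_self : halfStep C t m σ x x = g C t m σ x := by
  have h1 (s : SignType) : decisionMass C t m σ x 1 1 s * outRate C t x 1 s = outRate C t x 1 s *
      mixQ m σ (max (Real.log (outRate C t x 1 s / outRate C t x 0 (-s))) 0) := by
    -- An outcome of rate zero contributes nothing, whatever value the logarithm takes by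
    -- convention.
    rcases (outRate_nonneg (C := C) (t := t) hx 1 s).eq_or_lt with h | h
    · rw [← h, mul_zero, zero_mul]
    · rw [decisionMass_one_one hC ht hm hσ hx s h, mul_comm]
  have h0 (s : SignType) : decisionMass C t m σ x 1 0 s * outRate C t x 0 s = outRate C t x 0 s *
      mixQDiff m σ (Real.log (outRate C t x 0 s / outRate C t x 1 (-s))) *
        Ubar (Real.log (outRate C t x 0 s / outRate C t x 1 (-s))) := by
    rcases (outRate_nonneg (C := C) (t := t) hx 0 s).eq_or_lt with h | h
    · rw [← h, mul_zero, zero_mul, zero_mul]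
    · rw [decisionMass_one_zero hC ht hm hσ hx s h, mul_comm, mul_assoc]
  have n0 : -(0 : SignType) = 0 := rfl
  rw [halfStep, sum_zmod_two, sum_signType, sum_signType]
  simp_rw [h0, h1]
  simp only [g, fPe, fPc, fPeps, fQe, fQc, fQeps, binAvg_erased, binAvg_decProb, neg_neg, n0]
  ring

/-- The decoder confirms an error, and confirms a correct bit, with positive probability, and in
each case some half line of LLRs leaves that decision standing. This keeps the iteration where all
rate comparisons are valid. -/
theorem g_mem_Ioo : g C t m σ x ∈ Set.Ioo (0 : ℝ) 1 := by
  rw [← halfStep_self hC ht hm hσ hx]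
  have hnn (b r : ZMod 2) (s : SignType) : 0 ≤ decisionMass C t m σ x b r s * outRate C t x r s :=
    mul_nonneg measureReal_nonneg (outRate_nonneg hx r s)
  have hpos (b r : ZMod 2) (s : SignType)
      (h : 0 < decisionMass C t m σ x b r s * outRate C t x r s) :
      0 < ∑ r, ∑ s, decisionMass C t m σ x b r s * outRate C t x r s :=
    Finset.sum_pos' (fun _ _ => Finset.sum_nonneg fun _ _ => hnn _ _ _)
      ⟨r, Finset.mem_univ _, Finset.sum_pos' (fun _ _ => hnn _ _ _) ⟨s, Finset.mem_univ _, h⟩⟩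
  have hq := outRate_zero_one_pos (C := C) (t := t) hx
  have hp : 0 < outRate C t x 1 (-1) := by simpa using outRate_pos_swap hC ht hx 0 1 hq
  constructor
  · refine hpos 1 1 (-1) (mul_pos ?_ hp)
    rw [decisionMass_one_one hC ht hm hσ hx _ hp, ← symLlrLaw_real_Iio hm hσ]
    exact symLlrLaw_real_pos hm hσ (by simp)
  · have h1 := sum_decisionMass (C := C) (t := t) hm hσ x x
    have h2 : 0 < decisionMass C t m σ x 0 0 1 := by
      set a := Real.log (outRate C t x 0 1 / outRate C t x 1 (-1)) with ha
      have h : {l | hardBit l = 0 ∧ hardBit (softValue C t m σ x 1 l) = 0} =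
          Set.Ici (max 0 (-a)) := by
        ext l
        rw [Set.mem_ofPred_eq, Set.mem_Ici, hardBit_eq_zero_iff, max_le_iff]
        refine and_congr_right fun hl => ?_
        rw [softValue_eq hC ht hm hσ hx 0 1 hq l ((hardBit_eq_zero_iff l).2 hl),
          hardBit_eq_zero_iff, zero_add, ← ha, neg_le_iff_add_nonneg, add_comm]
      rw [decisionMass, h]
      exact symLlrLaw_real_pos hm hσ (by simp)
    have h3 := hpos 0 0 1 (mul_pos h2 hq)
    linarith

end Rule

theorem mixQ_zero_mem_Ioo (hm : 1 ≤ m) (hσ : 0 < σ) : mixQ m σ 0 ∈ Set.Ioo (0 : ℝ) 1 := by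
  have := isProbabilityMeasure_symLlrLaw hm hσ
  rw [← symLlrLaw_real_Iio hm hσ, neg_zero]
  refine ⟨symLlrLaw_real_pos hm hσ (by simp), ?_⟩
  have h1 := probReal_add_probReal_compl (μ := symLlrLaw m σ 0) (s := Set.Iio 0) measurableSet_Iio
  have h2 : 0 < (symLlrLaw m σ 0).real (Set.Iio 0)ᶜ := by
    rw [Set.compl_Iio]
    exact symLlrLaw_real_pos hm hσ (by simp)
  linarith

/-! ### The decoder as message passing -/

/-- The error probability with which the combining rule is run at each step. -/
def stepParam (xr xc : ℕ → ℝ) (d : ℕ) : ℝ := if Even d then xc (d / 2) else xr (d / 2 + 1)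

/-- Step `2 * ℓ` is the row step of iteration `ℓ + 1` and step `2 * ℓ + 1` its column step, so the
parameter of a step is the error probability of the messages it receives. -/
theorem stepParam_even (xr xc : ℕ → ℝ) (ℓ : ℕ) : stepParam xr xc (2 * ℓ) = xc ℓ := by
  rw [stepParam, if_pos (even_two_mul ℓ), Nat.mul_div_cancel_left ℓ (by norm_num)]

theorem stepParam_odd (xr xc : ℕ → ℝ) (ℓ : ℕ) : stepParam xr xc (2 * ℓ + 1) = xr (ℓ + 1) := by
  rw [stepParam, if_neg (by simp), show (2 * ℓ + 1) / 2 = ℓ by omega]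

/-- Seen from the column side, the interleaver is `π.symm`, the labels are `l ∘ π.symm`, and
variable node `v` is the socket `π v`. -/
theorem rowStep_eq_message (xr xc : ℕ → ℝ) {K : ℕ} (π : Equiv.Perm (Socket K (k + 1)))
    (l : Socket K (k + 1) → ℝ) (ℓ : ℕ) (ψ : Socket K (k + 1) → ZMod 2)
    (hψ : ∀ v, ψ v = message (nodeRule C t m σ (stepParam xr xc)) hardBit (2 * ℓ) π.symm
      (l ∘ π.symm) (π v)) (v : Socket K (k + 1)) :
    rowStep C t m σ (xc ℓ) l ψ v =
      message (nodeRule C t m σ (stepParam xr xc)) hardBit (2 * ℓ + 1) π l v := by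
  rw [rowStep, ← stepParam_even xr xc ℓ, cnMessage_eq_nodeRule, message]
  simp_rw [hψ]
  rfl

theorem colMsg_eq_message (xr xc : ℕ → ℝ) {K : ℕ} (π : Equiv.Perm (Socket K (k + 1)))
    (l : Socket K (k + 1) → ℝ) (ℓ : ℕ) : ∀ v, colMsg C t m σ xr xc π l ℓ v =
      message (nodeRule C t m σ (stepParam xr xc)) hardBit (2 * ℓ) π.symm (l ∘ π.symm) (π v) := by
  induction ℓ with
  | zero =>
    intro v
    simp [colMsg, message]
  | succ ℓ ih =>
    intro v
    have hrow := rowStep_eq_message xr xc π l ℓ _ ih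
    rw [colMsg, colStep, ← stepParam_odd xr xc ℓ, cnMessage_eq_nodeRule]
    simp_rw [hrow]
    rw [show 2 * (ℓ + 1) = 2 * ℓ + 1 + 1 by ring, message]
    simp only [Function.comp_apply, Equiv.symm_apply_apply, Equiv.symm_symm, sibling]
    congr 1
    funext i
    congr 1
    funext v
    simp

theorem rowMsgSucc_eq_message (xr xc : ℕ → ℝ) {K : ℕ} (π : Equiv.Perm (Socket K (k + 1)))
    (l : Socket K (k + 1) → ℝ) (ℓ : ℕ) (v : Socket K (k + 1)) :
    rowMsgSucc C t m σ xr xc π l ℓ v =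
      message (nodeRule C t m σ (stepParam xr xc)) hardBit (2 * ℓ + 1) π l v :=
  rowStep_eq_message xr xc π l ℓ _ (colMsg_eq_message xr xc π l ℓ) v

theorem avgErr_rowMsgSucc (xr xc : ℕ → ℝ) (ℓ K : ℕ) :
    (avgErr m σ (k + 1) K fun π l => rowMsgSucc C t m σ xr xc π l ℓ) =
      avgLaw (symLlrLaw m σ 0) (nodeRule C t m σ (stepParam xr xc)) hardBit (2 * ℓ + 1) K 1 := by
  simp only [avgErr, avgLaw, rowMsgSucc_eq_message]

/-- Relabelling by `π` exchanges the sides: inversion permutes the interleavers, `π` permutes the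
sockets, and independent identically distributed LLRs are invariant under permutation. -/
theorem avgErr_colMsg (hm : 1 ≤ m) (hσ : 0 < σ) (xr xc : ℕ → ℝ) (ℓ K : ℕ) :
    (avgErr m σ (k + 1) K fun π l => colMsg C t m σ xr xc π l ℓ) =
      avgLaw (symLlrLaw m σ 0) (nodeRule C t m σ (stepParam xr xc)) hardBit (2 * ℓ) K 1 := by
  have := isProbabilityMeasure_symLlrLaw hm hσ
  simp only [avgErr, avgLaw, colMsg_eq_message]
  congr 1
  refine Fintype.sum_equiv (Equiv.inv (Equiv.Perm (Socket K (k + 1)))) _ _ fun π =>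
    Fintype.sum_equiv π _ _ fun v => ?_
  exact (measurePreserving_comp_injective (symLlrLaw m σ 0) π.symm.injective).measureReal_preimage
    (measurableSet_message (measurableSet_nodeRule (stepParam xr xc)) measurableSet_hardBit
      (2 * ℓ) π.symm (π v) 1).nullMeasurableSet

/-- The message error probability after `d` steps of density evolution. -/
def errAfter (C : Submodule (ZMod 2) (Fin (k + 1) → ZMod 2)) (t m : ℕ) (σ : ℝ) (xr xc : ℕ → ℝ)
    (d : ℕ) : ℝ :=
  evolve (symLlrLaw m σ 0) (nodeRule C t m σ (stepParam xr xc)) hardBit d 1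

theorem tendsto_avgErr (C : Submodule (ZMod 2) (Fin (k + 1) → ZMod 2)) (t : ℕ) (hm : 1 ≤ m)
    (hσ : 0 < σ) (xr xc : ℕ → ℝ) (ℓ : ℕ) :
    Tendsto (fun K => avgErr m σ (k + 1) K fun π l => colMsg C t m σ xr xc π l ℓ) atTop
      (𝓝 (errAfter C t m σ xr xc (2 * ℓ))) ∧
    Tendsto (fun K => avgErr m σ (k + 1) K fun π l => rowMsgSucc C t m σ xr xc π l ℓ) atTop
      (𝓝 (errAfter C t m σ xr xc (2 * ℓ + 1))) := by
  have := isProbabilityMeasure_symLlrLaw hm hσ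
  simp_rw [avgErr_colMsg hm hσ, avgErr_rowMsgSucc]
  exact ⟨tendsto_avgLaw (measurableSet_nodeRule _) measurableSet_hardBit _ _,
    tendsto_avgLaw (measurableSet_nodeRule _) measurableSet_hardBit _ _⟩

/-- Existence half: a decoder tuned with the orbit `z` of `g` realizes that orbit. -/
theorem errAfter_eq_of_stepParam_eq (hC : ∀ j, ∃ c ∈ C, c j = 1) (ht : t = (minDist C - 1) / 2)
    (hm : 1 ≤ m) (hσ : 0 < σ) {xr xc : ℕ → ℝ} {z : ℕ → ℝ} (h0 : z 0 = mixQ m σ 0)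
    (hz : ∀ d, z (d + 1) = g C t m σ (z d)) (hs : ∀ d, stepParam xr xc d = z d) (d : ℕ) :
    errAfter C t m σ xr xc d = z d ∧ z d ∈ Set.Ioo (0 : ℝ) 1 := by
  induction d with
  | zero => exact ⟨(evolve_nodeRule_zero hm hσ _).trans h0.symm, h0 ▸ mixQ_zero_mem_Ioo hm hσ⟩
  | succ d ih =>
    obtain ⟨h1, h2⟩ := ih
    refine ⟨?_, (hz d).symm ▸ g_mem_Ioo hC ht hm hσ h2⟩
    rw [errAfter, evolve_nodeRule_succ hm hσ, ← errAfter, h1, hs,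
      halfStep_self hC ht hm hσ h2, hz]

/-- Uniqueness half: a decoder tuned with its own error probabilities must follow `g`. Membership in
`(0, 1)` is carried along the induction, because `halfStep_self` requires it. -/
theorem errAfter_succ_of_stepParam_eq (hC : ∀ j, ∃ c ∈ C, c j = 1)
    (ht : t = (minDist C - 1) / 2) (hm : 1 ≤ m) (hσ : 0 < σ) {xr xc : ℕ → ℝ}
    (hs : ∀ d, stepParam xr xc d = errAfter C t m σ xr xc d) (d : ℕ) :
    errAfter C t m σ xr xc (d + 1) = g C t m σ (errAfter C t m σ xr xc d) := by
  have hstep (d : ℕ) (h : errAfter C t m σ xr xc d ∈ Set.Ioo (0 : ℝ) 1) :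
      errAfter C t m σ xr xc (d + 1) = g C t m σ (errAfter C t m σ xr xc d) := by
    rw [errAfter, evolve_nodeRule_succ hm hσ, ← errAfter, hs, halfStep_self hC ht hm hσ h]
  have hmem (d : ℕ) : errAfter C t m σ xr xc d ∈ Set.Ioo (0 : ℝ) 1 := by
    induction d with
    | zero =>
      rw [errAfter, evolve_nodeRule_zero hm hσ]
      exact mixQ_zero_mem_Ioo hm hσ
    | succ d ih =>
      rw [hstep d ih]
      exact g_mem_Ioo hC ht hm hσ ih
  exact hstep d (hmem d)

/-- The message error probabilities along density evolution, one half-iteration per step. -/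
def densityEvolution (C : Submodule (ZMod 2) (Fin (k + 1) → ZMod 2)) (t m : ℕ) (σ : ℝ) : ℕ → ℝ
  | 0 => mixQ m σ 0
  | d + 1 => g C t m σ (densityEvolution C t m σ d)

theorem isMessageErrorProb_densityEvolution (hC : ∀ j, ∃ c ∈ C, c j = 1)
    (ht : t = (minDist C - 1) / 2) (hm : 1 ≤ m) (hσ : 0 < σ) :
    IsMessageErrorProb C t m σ (fun ℓ => densityEvolution C t m σ (2 * ℓ - 1))
      fun ℓ => densityEvolution C t m σ (2 * ℓ) := by
  -- Truncated subtraction gives `xr 0` a meaningless value; no step of the decoder and no limit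
  -- refers to it.
  set xr : ℕ → ℝ := fun ℓ => densityEvolution C t m σ (2 * ℓ - 1)
  set xc : ℕ → ℝ := fun ℓ => densityEvolution C t m σ (2 * ℓ)
  have hs (d : ℕ) : stepParam xr xc d = densityEvolution C t m σ d := by
    obtain ⟨ℓ, rfl | rfl⟩ := Nat.even_or_odd' d
    · exact stepParam_even xr xc ℓ
    · exact stepParam_odd xr xc ℓ
  have hE (d : ℕ) : errAfter C t m σ xr xc d = densityEvolution C t m σ d :=
    (errAfter_eq_of_stepParam_eq hC ht hm hσ rfl (fun _ => rfl) hs d).1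
  refine ⟨fun ℓ => ?_, fun ℓ => ?_⟩
  · rw [show xc ℓ = errAfter C t m σ xr xc (2 * ℓ) from (hE _).symm]
    exact (tendsto_avgErr C t hm hσ xr xc ℓ).1
  · rw [show xr (ℓ + 1) = errAfter C t m σ xr xc (2 * ℓ + 1) from (hE _).symm]
    exact (tendsto_avgErr C t hm hσ xr xc ℓ).2

end

end IBDDCR

theorem proposition2 (n : ℕ) (hn : 0 < n) (C : Submodule (ZMod 2) (Fin n → ZMod 2))
    (hC : ∀ j : Fin n, ∃ c ∈ C, c j = 1)
    (t : ℕ) (ht : t = (IBDDCR.minDist C - 1) / 2)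
    (m : ℕ) (hm : 1 ≤ m) (σ : ℝ) (hσ : 0 < σ) :
    (∃ xr xc : ℕ → ℝ, IBDDCR.IsMessageErrorProb C t m σ xr xc) ∧
    ∀ xr xc : ℕ → ℝ, IBDDCR.IsMessageErrorProb C t m σ xr xc →
      xc 0 = ∑ j ∈ Finset.range (2 ^ m / 2),
        IBDDCR.weight m j * IBDDCR.Q (IBDDCR.mean m σ j / IBDDCR.sd m σ j) ∧
      ∀ ℓ : ℕ, 1 ≤ ℓ →
        xr ℓ = IBDDCR.g C t m σ (xc (ℓ - 1)) ∧ xc ℓ = IBDDCR.g C t m σ (xr ℓ) := by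
  obtain ⟨k, rfl⟩ : ∃ k, n = k + 1 := ⟨n - 1, by omega⟩
  refine ⟨⟨_, _, IBDDCR.isMessageErrorProb_densityEvolution hC ht hm hσ⟩, ?_⟩
  rintro xr xc ⟨hcol, hrow⟩
  have hc (ℓ : ℕ) : xc ℓ = IBDDCR.errAfter C t m σ xr xc (2 * ℓ) :=
    tendsto_nhds_unique (hcol ℓ) (IBDDCR.tendsto_avgErr C t hm hσ xr xc ℓ).1
  have hr (ℓ : ℕ) : xr (ℓ + 1) = IBDDCR.errAfter C t m σ xr xc (2 * ℓ + 1) :=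
    tendsto_nhds_unique (hrow ℓ) (IBDDCR.tendsto_avgErr C t hm hσ xr xc ℓ).2
  -- Uniqueness of limits turns the hypothesis on `xr` and `xc` into self-consistency of the decoder
  -- parameters.
  have hs (d : ℕ) : IBDDCR.stepParam xr xc d = IBDDCR.errAfter C t m σ xr xc d := by
    obtain ⟨ℓ, rfl | rfl⟩ := Nat.even_or_odd' d
    · rw [IBDDCR.stepParam_even, hc]
    · rw [IBDDCR.stepParam_odd, hr]
  have hg := IBDDCR.errAfter_succ_of_stepParam_eq hC ht hm hσ hs
  constructor
  · rw [hc, IBDDCR.errAfter, Nat.mul_zero, IBDDCR.evolve_nodeRule_zero hm hσ, IBDDCR.mixQ]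
    simp only [zero_add]
  · intro ℓ hℓ
    obtain ⟨ℓ, rfl⟩ : ∃ ℓ', ℓ = ℓ' + 1 := ⟨ℓ - 1, by omega⟩
    rw [Nat.add_sub_cancel, hr, hc, hc]
    exact ⟨hg _, hg _⟩
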